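/- Let $W_\infty=\bigcup_n W_n$ be the group of signed permutations: bijections $w$ of $\mathbb Z$ with $w(-i)=-w(i)$ that move only finitely many integers, where $w\in W_n$ means that $w(i)=i$ for all $i>n$. Let $S_\infty\subset W_\infty$ be the subgroup of those $w$ with $w(i)>0$ for all $i>0$. It is generated by $s_1,s_2,\dots$, where $s_i$ exchanges $i$ and $i+1$, and $W_\infty$ is generated by these together with $s_0$, the sign change $1\mapsto -1$. Let $\ell(w)$ be the least length of an expression of $w$ as a product of the $s_i$, $i\ge 0$. A *descent position* of $w$ is an integer $r\ge 0$ with $\ell(ws_r)<\ell(w)$. The nilCoxeter algebra of $W_n$ (over a commutative ring of scalars) is the associative algebra with unit generated by $u_0,\dots,u_{n-1}$ with relations $u_i^2=0$; $u_iu_j=u_ju_i$ for $|i-j|\ge 2$; $u_iu_{i+1}u_i=u_{i+1}u_iu_{i+1}$ for $i\ge 1$; $u_0u_1u_0u_1=u_1u_0u_1u_0$. It has a basis $(u_w)_{w\in W_n}$, where $u_w=u_{c_1}\cdots u_{c_\ell}$ for any reduced word $c_1\cdots c_\ell$ of $w$; write $\langle \xi,w\rangle$ for the coefficient of $u_w$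 in $\xi$. Set $$A_i(t)=(1+tu_{n-1})\cdots(1+tu_i),\qquad \tilde A_i(t)=(1-tu_i)\cdots(1-tu_{n-1}),$$ $$C(t)=(1+tu_{n-1})\cdots(1+tu_1)(1+tu_0)(1+tu_0)(1+tu_1)\cdots(1+tu_{n-1}).$$ Let $X=(x_1,x_2,\dots)$, $Y=(y_1,y_2,\dots)$, $Z=(z_1,z_2,\dots)$ be sequences of commuting independent variables, and put $C(X)=C(x_1)C(x_2)\cdots$. For $w\in W_n$, the type C double Schubert polynomial is $$\mathfrak{CS}_w(X;Y,Z)=\big\langle \tilde A_{n-1}(z_{n-1})\cdots\tilde A_1(z_1)\,C(X)\,A_1(y_1)\cdots A_{n-1}(y_{n-1}),\,w\big\rangle .$$ For finite alphabets $Y'$ and $Z'$ put $A(Y')=\prod_{y\in Y'}A_1(y)$ and $\tilde A(Z')=\prod_{z\in Z'}\tilde A_1(z)$ (the order of the factors is immaterial), and define the double Stanley function and the double mixed Stanley function by $$G_v(Y'/Z')=\langle\tilde A(Z')A(Y'),v\rangle\ \ (v\in S_\infty),\qquad J_v(X;Y'/Z')=\langle \tilde A(Z')\,C(X)\,A(Y'),v\rangle\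 \ (v\in W_\infty).$$ Write $G_v(Y')$ and $G_v(0/Z')$ for the cases of an empty $Z'$ and an empty $Y'$, respectively. None of these depends on the choice of $n$ (with $w\in W_n$, respectively $v\in W_n$). Let $p,q\ge 1$, let $a_1<\dots<a_p$ and $b_1<\dots<b_q$ be sequences of nonnegative integers, and set $a_0=b_0=0$, $Y_i=\{y_{a_{i-1}+1},\dots,y_{a_i}\}$ and $Z_j=\{z_{b_{j-1}+1},\dots,z_{b_j}\}$. **Proposition.** Let $w\in W_\infty$ be such that every descent position of $w$ is one of $a_1,\dots,a_p$ and every descent position of $w^{-1}$ is one of $b_1,\dots,b_q$. Then $$\mathfrak{CS}_w(X;Y,Z)=\sum G_{u_1}(0/Z_q)\cdots G_{u_{q-1}}(0/Z_2)\;J_{u_q}(X;Y_1/Z_1)\;G_{u_{q+1}}(Y_2)\cdots G_{u_{p+q-1}}(Y_p),$$ where the sum is over the (finitely many) tuples $(u_1,\dots,u_{p+q-1})$ of elements of $W_\infty$ with $u_1\cdots u_{p+q-1}=w$ and $\ell(u_1)+\dots+\ell(u_{p+q-1})=\ell(w)$, such that $u_j\in S_\infty$ for all $j\neq q$, $u_j(i)=i$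 whenever $j<q$ and $1\le i\le b_{q-j}$, and $u_j(i)=i$ whenever $j>q$ and $1\le i\le a_{j-q}$. -/

import Mathlib

/-! ## The hyperoctahedral group of all signed permutations -/

/-- The group `W_∞` of signed permutations: bijections `w` of `ℤ` (under composition) with
`w (-i) = - w i` that move only finitely many integers. -/
def signedPermSubgroup : Subgroup (Equiv.Perm ℤ) where
  carrier := {w | (∀ i, w (-i) = -(w i)) ∧ {i | w i ≠ i}.Finite}
  one_mem' := by simp
  mul_mem' := by
    rintro v w ⟨hv, hvf⟩ ⟨hw, hwf⟩
    refine ⟨fun i => by simp [hw, hv], (hvf.union hwf).subset ?_⟩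
    intro i hi
    by_contra h
    simp only [Set.mem_union, Set.mem_ofPred_eq, not_or, not_not] at h
    exact hi (by rw [Equiv.Perm.mul_apply, h.2, h.1])
  inv_mem' := by
    rintro w ⟨hw, hwf⟩
    refine ⟨fun i => ?_, hwf.subset ?_⟩
    · apply w.injective
      rw [hw]
      simp
    · intro i hi h
      apply hi
      nth_rewrite 1 [← h]
      simp

/-- `W_∞`. -/
abbrev SignedPerm : Type := ↥signedPermSubgroup

namespace SignedPerm

/-- The value `w(i)`. -/
def eval (w : SignedPerm) (i : ℤ) : ℤ := (w : Equiv.Perm ℤ) i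

/-- `w` belongs to `W_n`, that is, `w` fixes every integer larger than `n`. -/
def MemW (n : ℕ) (w : SignedPerm) : Prop := ∀ i : ℤ, (n : ℤ) < i → w.eval i = i

/-- `w` belongs to `S_∞`, that is, `w` has no negative values on positive integers. -/
def MemS (w : SignedPerm) : Prop := ∀ i : ℤ, 0 < i → 0 < w.eval i

/-- The least `n` with `w ∈ W_n`. -/
noncomputable def rank (w : SignedPerm) : ℕ := sInf {n | w.MemW n}

/-- The simple reflections as bijections of `ℤ`: the sign change `1 ↦ -1` for `i = 0`, and the
transposition of `i` and `i + 1` (and of `-i` and `-(i + 1)`) for `i ≥ 1`. -/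
def simplePerm (i : ℕ) : Equiv.Perm ℤ :=
  if i = 0 then Equiv.swap 1 (-1)
  else Equiv.swap (i : ℤ) (i + 1) * Equiv.swap (-(i : ℤ)) (-(i + 1))

lemma simplePerm_zero_apply (j : ℤ) :
    simplePerm 0 j = if j = 1 then -1 else if j = -1 then 1 else j := by
  simp [simplePerm, Equiv.swap_apply_def]

lemma simplePerm_pos_apply {i : ℕ} (hi : i ≠ 0) (j : ℤ) :
    simplePerm i j = if j = i then (i : ℤ) + 1 else if j = i + 1 then (i : ℤ)
      else if j = -i then -(i + 1) else if j = -(i + 1) then -(i : ℤ) else j := by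
  simp only [simplePerm, hi, if_false, Equiv.Perm.mul_apply, Equiv.swap_apply_def]
  split_ifs <;> omega

lemma simplePerm_mem (i : ℕ) : simplePerm i ∈ signedPermSubgroup := by
  refine ⟨fun j => ?_, ?_⟩
  · by_cases hi : i = 0
    · subst hi
      simp only [simplePerm_zero_apply]
      split_ifs <;> omega
    · simp only [simplePerm_pos_apply hi]
      split_ifs <;> omega
  · refine (Set.finite_Icc (-((i : ℤ) + 1)) (i + 1)).subset ?_
    intro j hj
    by_contra h
    apply hj
    simp only [Set.mem_Icc, not_and_or, not_le] at h
    by_cases hi : i = 0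
    · subst hi
      simp only [simplePerm_zero_apply]
      split_ifs <;> omega
    · simp only [simplePerm_pos_apply hi]
      split_ifs <;> omega

/-- The simple reflection `s_i`, for `i = 0, 1, 2, …`. -/
def simple (i : ℕ) : SignedPerm := ⟨simplePerm i, simplePerm_mem i⟩

/-- The product `s_{a_1} ⋯ s_{a_ℓ}` of a word `a_1 ⋯ a_ℓ`. -/
def wordProd (a : List ℕ) : SignedPerm := (a.map simple).prod

/-- The length `ℓ(w)`: the least `ℓ` such that `w` is a product of `ℓ` simple reflections. -/
noncomputable def length (w : SignedPerm) : ℕ :=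
  sInf {l | ∃ a : List ℕ, a.length = l ∧ wordProd a = w}

/-- `w` has a descent at position `r`. -/
def IsDescent (w : SignedPerm) (r : ℕ) : Prop := (w * simple r).length < w.length

lemma ext_eval {v w : SignedPerm} (h : ∀ i, v.eval i = w.eval i) : v = w :=
  Subtype.ext (Equiv.ext h)

lemma eval_mul (v w : SignedPerm) (i : ℤ) : (v * w).eval i = v.eval (w.eval i) := rfl

lemma eval_one (i : ℤ) : (1 : SignedPerm).eval i = i := rfl

lemma eval_neg (w : SignedPerm) (i : ℤ) : w.eval (-i) = -(w.eval i) := w.2.1 i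

lemma eval_injective (w : SignedPerm) : Function.Injective w.eval := (w : Equiv.Perm ℤ).injective

lemma eval_simple_zero (j : ℤ) :
    (simple 0).eval j = if j = 1 then -1 else if j = -1 then 1 else j :=
  simplePerm_zero_apply j

lemma eval_simple_pos {i : ℕ} (hi : i ≠ 0) (j : ℤ) :
    (simple i).eval j = if j = i then (i : ℤ) + 1 else if j = i + 1 then (i : ℤ)
      else if j = -i then -(i + 1) else if j = -(i + 1) then -(i : ℤ) else j :=
  simplePerm_pos_apply hi j

lemma ext_pos {v w : SignedPerm} (h : ∀ i : ℤ, 0 < i → v.eval i = w.eval i) : v = w := by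
  have h0 : ∀ u : SignedPerm, u.eval 0 = 0 := fun u => by
    have := u.eval_neg 0
    simp only [neg_zero] at this
    omega
  apply ext_eval
  intro i
  rcases lt_trichotomy i 0 with hi | rfl | hi
  · have := h (-i) (by omega)
    rw [eval_neg, eval_neg] at this
    omega
  · rw [h0, h0]
  · exact h i hi

lemma eval_simple_self {i : ℕ} (hi : i ≠ 0) : (simple i).eval i = i + 1 := by
  rw [eval_simple_pos hi, if_pos rfl]

lemma eval_simple_succ {i : ℕ} (hi : i ≠ 0) : (simple i).eval (i + 1) = i := by
  rw [eval_simple_pos hi]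
  split_ifs <;> omega

lemma eval_simple_of_ne {i : ℕ} {k : ℤ} (hk : 0 < k) (h1 : k ≠ i) (h2 : k ≠ i + 1) :
    (simple i).eval k = k := by
  by_cases hi : i = 0
  · subst hi
    rw [eval_simple_zero]
    split_ifs <;> simp_all
  · rw [eval_simple_pos hi]
    split_ifs <;> omega

lemma eval_simple_zero_one : (simple 0).eval 1 = -1 := by
  rw [eval_simple_zero, if_pos rfl]

lemma wordProd_append (a b : List ℕ) : wordProd (a ++ b) = wordProd a * wordProd b := by
  simp [wordProd]

lemma wordProd_cons (i : ℕ) (a : List ℕ) : wordProd (i :: a) = simple i * wordProd a := by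
  simp [wordProd]

lemma simple_mul_simple_self (i : ℕ) : simple i * simple i = 1 := by
  apply ext_pos
  intro k hk
  rw [eval_mul, eval_one]
  by_cases h1 : k = i
  · subst h1
    have hi : i ≠ 0 := by omega
    rw [eval_simple_self hi, eval_simple_succ hi]
  by_cases h2 : k = i + 1
  · subst h2
    by_cases hi : i = 0
    · subst hi
      norm_num [eval_simple_zero_one, eval_neg]
    · rw [eval_simple_succ hi, eval_simple_self hi]
  rw [eval_simple_of_ne hk h1 h2, eval_simple_of_ne hk h1 h2]

lemma simple_comm {i j : ℕ} (h : i + 2 ≤ j) : simple i * simple j = simple j * simple i := by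
  apply ext_pos
  intro k hk
  have hj : j ≠ 0 := by omega
  rw [eval_mul, eval_mul]
  by_cases h1 : k = i
  · subst h1
    have hi : i ≠ 0 := by omega
    rw [eval_simple_of_ne (i := j) hk (by omega) (by omega), eval_simple_self hi,
      eval_simple_of_ne (by omega) (by omega) (by omega)]
  by_cases h2 : k = i + 1
  · subst h2
    rw [eval_simple_of_ne (i := j) hk (by omega) (by omega)]
    by_cases hi : i = 0
    · subst hi
      simp only [Nat.cast_zero, zero_add, eval_simple_zero_one, eval_neg]
      rw [eval_simple_of_ne (by omega) (by omega) (by omega)]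
    · rw [eval_simple_succ hi, eval_simple_of_ne (by omega) (by omega) (by omega)]
  rw [eval_simple_of_ne (i := i) hk h1 h2]
  by_cases h3 : k = j
  · subst h3
    rw [eval_simple_self hj, eval_simple_of_ne (by omega) (by omega) (by omega)]
  by_cases h4 : k = j + 1
  · subst h4
    rw [eval_simple_succ hj, eval_simple_of_ne (by omega) (by omega) (by omega)]
  rw [eval_simple_of_ne hk h3 h4, eval_simple_of_ne hk h1 h2]

lemma simple_braid {i : ℕ} (hi : i ≠ 0) :
    simple i * simple (i + 1) * simple i = simple (i + 1) * simple i * simple (i + 1) := by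
  have e1 := eval_simple_self hi
  have e2 := eval_simple_succ hi
  have e3 := eval_simple_self (Nat.succ_ne_zero i)
  have e4 := eval_simple_succ (Nat.succ_ne_zero i)
  have e5 : (simple i).eval (i + 1 + 1) = i + 1 + 1 :=
    eval_simple_of_ne (by omega) (by omega) (by omega)
  have e6 : (simple (i + 1)).eval i = i :=
    eval_simple_of_ne (by omega) (by push_cast; omega) (by push_cast; omega)
  simp only [Nat.succ_eq_add_one, Nat.cast_add, Nat.cast_one] at e3 e4
  apply ext_pos
  intro k hk
  simp only [eval_mul]
  by_cases h1 : k = i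
  · subst h1
    rw [e6, e1, e3, e5]
  by_cases h2 : k = i + 1
  · subst h2
    rw [e2, e6, e1, e3, e5, e4]
  by_cases h3 : k = i + 1 + 1
  · subst h3
    rw [e5, e4, e2, e6]
  have f1 := eval_simple_of_ne hk h1 h2
  have f2 : (simple (i + 1)).eval k = k :=
    eval_simple_of_ne hk (by push_cast; omega) (by push_cast; omega)
  rw [f1, f2, f1, f2]

lemma simple_braid_zero :
    simple 0 * simple 1 * simple 0 * simple 1 = simple 1 * simple 0 * simple 1 * simple 0 := by
  have e1 : (simple 1).eval 1 = 2 := eval_simple_self one_ne_zero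
  have e2 : (simple 1).eval 2 = 1 := eval_simple_succ one_ne_zero
  have e3 : (simple 0).eval 2 = 2 := eval_simple_of_ne (by omega) (by simp) (by simp)
  apply ext_pos
  intro k hk
  simp only [eval_mul]
  by_cases h1 : k = 1
  · subst h1
    simp only [e1, e2, e3, eval_simple_zero_one, eval_neg]
  by_cases h2 : k = 2
  · subst h2
    simp only [e1, e2, e3, eval_simple_zero_one, eval_neg]
  have f1 : (simple 0).eval k = k := eval_simple_of_ne hk (by simp; omega) (by simp; omega)
  have f2 : (simple 1).eval k = k := eval_simple_of_ne hk (by simp; omega) (by simp; omega)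
  simp only [f1, f2]

lemma exists_memW (w : SignedPerm) : ∃ n, w.MemW n := by
  obtain ⟨B, hB⟩ := w.2.2.bddAbove
  refine ⟨B.toNat, fun i hi => ?_⟩
  by_contra h
  have := hB (show i ∈ {i | (w : Equiv.Perm ℤ) i ≠ i} from h)
  omega

lemma abs_eval_le {n : ℕ} {w : SignedPerm} (hw : w.MemW n) {i : ℤ} (hi : |i| ≤ n) :
    |w.eval i| ≤ n := by
  rw [abs_le] at *
  constructor
  · by_contra h
    have h2 := hw (-(w.eval i)) (by omega)
    rw [← eval_neg] at h2
    have := w.eval_injective h2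
    rw [eval_neg] at this
    omega
  · by_contra h
    have := w.eval_injective (hw (w.eval i) (by omega))
    omega

lemma exists_word_of_pos (n : ℕ) (d : ℕ) : ∀ k : ℕ, 0 < k → k + d = n + 1 →
    ∃ a : List ℕ, (wordProd a).MemW (n + 1) ∧ (wordProd a).eval k = n + 1 := by
  induction d with
  | zero =>
    intro k _ hk
    refine ⟨[], fun i _ => rfl, ?_⟩
    change (k : ℤ) = n + 1
    omega
  | succ d ih =>
    intro k hk hkd
    obtain ⟨a, ha, hak⟩ := ih (k + 1) (by omega) (by omega)
    refine ⟨a ++ [k], ?_, ?_⟩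
    · intro i hi
      rw [wordProd_append, eval_mul, show wordProd [k] = simple k by simp [wordProd],
        eval_simple_of_ne (by omega) (by push_cast at hi; omega) (by push_cast at hi; omega)]
      exact ha i hi
    · rw [wordProd_append, eval_mul, show wordProd [k] = simple k by simp [wordProd],
        eval_simple_self (by omega)]
      exact_mod_cast hak

lemma exists_word_of_neg (n : ℕ) : ∀ k : ℕ, k ≤ n →
    ∃ a : List ℕ, (wordProd a).MemW (n + 1) ∧ (wordProd a).eval (-(k + 1)) = n + 1 := by
  intro k
  induction k with
  | zero =>
    intro _
    obtain ⟨a, ha, hak⟩ := exists_word_of_pos n n 1 (by omega) (by omega)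
    refine ⟨a ++ [0], ?_, ?_⟩
    · intro i hi
      rw [wordProd_append, eval_mul, show wordProd [0] = simple 0 by simp [wordProd],
        eval_simple_of_ne (by omega) (by push_cast at *; omega) (by push_cast at *; omega)]
      exact ha i hi
    · rw [wordProd_append, eval_mul, show wordProd [0] = simple 0 by simp [wordProd], eval_neg]
      simp only [Nat.cast_zero, zero_add, eval_simple_zero_one, neg_neg]
      exact_mod_cast hak
  | succ k ih =>
    intro hk
    obtain ⟨a, ha, hak⟩ := ih (by omega)
    refine ⟨a ++ [k + 1], ?_, ?_⟩
    · intro i hi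
      rw [wordProd_append, eval_mul, show wordProd [k + 1] = simple (k + 1) by simp [wordProd],
        eval_simple_of_ne (by omega) (by push_cast at *; omega) (by push_cast at *; omega)]
      exact ha i hi
    · rw [wordProd_append, eval_mul, show wordProd [k + 1] = simple (k + 1) by simp [wordProd],
        eval_neg, eval_simple_succ (by omega), ← hak]
      push_cast
      rfl

lemma wordProd_reverse_mul (a : List ℕ) : wordProd a.reverse * wordProd a = 1 := by
  induction a with
  | nil => simp [wordProd]
  | cons i a ih =>
    rw [List.reverse_cons, wordProd_append, wordProd_cons, wordProd_cons]
    rw [show wordProd [] = 1 by simp [wordProd], mul_one, mul_assoc, ← mul_assoc (simple i),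
      simple_mul_simple_self, one_mul, ih]

/-- `W_∞` is generated by the simple reflections. -/
theorem exists_word (w : SignedPerm) : ∃ a : List ℕ, wordProd a = w := by
  obtain ⟨n, hn⟩ := w.exists_memW
  induction n generalizing w with
  | zero =>
    refine ⟨[], ?_⟩
    apply ext_pos
    intro i hi
    exact (hn i (by simpa using hi)).symm
  | succ n ih =>
    have key : ∃ a : List ℕ, (wordProd a).MemW (n + 1) ∧
        (wordProd a).eval (w.eval (n + 1)) = n + 1 := by
      have hle := abs_eval_le hn (i := n + 1) (by rw [abs_of_nonneg (by omega)]; simp)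
      have hne : w.eval (n + 1) ≠ 0 := by
        intro h
        have h2 := w.eval_neg (n + 1)
        rw [h, neg_zero, ← h] at h2
        have := w.eval_injective h2
        omega
      rw [abs_le] at hle
      push_cast at hle
      rcases lt_or_gt_of_ne hne with h | h
      · obtain ⟨k, hk⟩ : ∃ k : ℕ, w.eval (n + 1) = -(k + 1) :=
          ⟨(-(w.eval (n + 1)) - 1).toNat, by omega⟩
        rw [hk]
        exact exists_word_of_neg n k (by omega)
      · obtain ⟨k, hk⟩ : ∃ k : ℕ, w.eval (n + 1) = k := ⟨(w.eval (n + 1)).toNat, by omega⟩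
        rw [hk]
        exact exists_word_of_pos n (n + 1 - k) k (by omega) (by omega)
    obtain ⟨a, ha, hak⟩ := key
    obtain ⟨b, hb⟩ := ih (wordProd a * w) (by
      intro i hi
      rw [eval_mul]
      by_cases h : i = n + 1
      · rw [h, hak]
      · rw [hn i (by push_cast; omega), ha i (by push_cast; omega)])
    refine ⟨a.reverse ++ b, ?_⟩
    rw [wordProd_append, hb, ← mul_assoc, wordProd_reverse_mul, one_mul]

lemma length_wordProd_le (a : List ℕ) : (wordProd a).length ≤ a.length :=
  Nat.sInf_le ⟨a, rfl, rfl⟩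

/-- Every element has a reduced word. -/
lemma exists_reduced_word (w : SignedPerm) :
    ∃ a : List ℕ, a.length = w.length ∧ wordProd a = w := by
  obtain ⟨a, ha⟩ := w.exists_word
  exact Nat.sInf_mem (s := {l | ∃ a : List ℕ, a.length = l ∧ wordProd a = w}) ⟨_, a, rfl, ha⟩

lemma length_mul_le (v w : SignedPerm) : (v * w).length ≤ v.length + w.length := by
  obtain ⟨a, ha, rfl⟩ := v.exists_reduced_word
  obtain ⟨b, hb, rfl⟩ := w.exists_reduced_word
  rw [← wordProd_append, ← ha, ← hb, ← List.length_append]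
  exact length_wordProd_le _

lemma length_one : (1 : SignedPerm).length = 0 :=
  Nat.le_zero.mp (length_wordProd_le [])

end SignedPerm

/-! ## The nilCoxeter algebra -/

namespace NilCoxeter

open SignedPerm

variable (R : Type*) [CommRing R]

/-- The defining relations among the generators `u_0, u_1, u_2, …`. -/
inductive Rel : FreeAlgebra R ℕ → FreeAlgebra R ℕ → Prop
  | sq (i : ℕ) : Rel (FreeAlgebra.ι R i * FreeAlgebra.ι R i) 0
  | comm (i j : ℕ) (h : i + 2 ≤ j) :
      Rel (FreeAlgebra.ι R i * FreeAlgebra.ι R j) (FreeAlgebra.ι R j * FreeAlgebra.ι R i)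
  | braid (i : ℕ) (h : 0 < i) :
      Rel (FreeAlgebra.ι R i * FreeAlgebra.ι R (i + 1) * FreeAlgebra.ι R i)
        (FreeAlgebra.ι R (i + 1) * FreeAlgebra.ι R i * FreeAlgebra.ι R (i + 1))
  | braidZero :
      Rel (FreeAlgebra.ι R 0 * FreeAlgebra.ι R 1 * FreeAlgebra.ι R 0 * FreeAlgebra.ι R 1)
        (FreeAlgebra.ι R 1 * FreeAlgebra.ι R 0 * FreeAlgebra.ι R 1 * FreeAlgebra.ι R 0)

end NilCoxeter

/-- The nilCoxeter algebra of `W_∞` with scalars `R`: the free associative `R`-algebra on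
`u_0, u_1, u_2, …` modulo the nilCoxeter relations. The algebra attached to `W_n` is the
subalgebra generated by `u_0, …, u_{n-1}`. -/
abbrev NilCoxeter (R : Type*) [CommRing R] : Type _ := RingQuot (NilCoxeter.Rel R)

namespace NilCoxeter

open SignedPerm

variable {R : Type*} [CommRing R]

/-- The generator `u_i`. -/
noncomputable def gen (i : ℕ) : NilCoxeter R :=
  RingQuot.mkAlgHom R (NilCoxeter.Rel R) (FreeAlgebra.ι R i)

open Classical in
/-- Left multiplication by `u_i` on the free module with basis `W_∞`:
`u_i · w = s_i w` if `ℓ(s_i w) = ℓ(w) + 1`, and `u_i · w = 0` otherwise. -/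
noncomputable def leftMul (i : ℕ) : Module.End R (SignedPerm →₀ R) :=
  Finsupp.linearCombination R fun w =>
    if (simple i * w).length = w.length + 1 then Finsupp.single (simple i * w) 1 else 0

open Classical in
lemma prod_leftMul_single (a : List ℕ) (w : SignedPerm) :
    (a.map (leftMul (R := R))).prod (Finsupp.single w 1) =
      if (wordProd a * w).length = a.length + w.length
      then Finsupp.single (wordProd a * w) 1 else 0 := by
  induction a with
  | nil => simp [wordProd]
  | cons i a ih =>
    rw [List.map_cons, List.prod_cons, Module.End.mul_apply, ih, wordProd_cons, mul_assoc,
      List.length_cons]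
    have h1 := length_mul_le (simple i) (wordProd a * w)
    have h2 := length_mul_le (wordProd a) w
    have h3 := length_wordProd_le a
    have h4 : (simple i).length ≤ 1 := by
      have := length_wordProd_le [i]
      simpa [wordProd] using this
    split_ifs with h h' h'
    · rw [leftMul, Finsupp.linearCombination_single, one_smul, if_pos (by omega)]
    · rw [leftMul, Finsupp.linearCombination_single, one_smul, if_neg (by omega)]
    · omega
    · simp

lemma prod_leftMul_congr {a b : List ℕ} (hl : a.length = b.length)
    (hp : wordProd a = wordProd b) :
    (a.map (leftMul (R := R))).prod = (b.map (leftMul (R := R))).prod := by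
  apply Finsupp.lhom_ext'
  intro w
  apply LinearMap.ext_ring
  simp only [LinearMap.comp_apply, Finsupp.lsingle_apply, prod_leftMul_single, hl, hp]

variable (R) in
lemma lift_leftMul_rel ⦃x y : FreeAlgebra R ℕ⦄ (h : Rel R x y) :
    FreeAlgebra.lift R (leftMul (R := R)) x = FreeAlgebra.lift R (leftMul (R := R)) y := by
  cases h with
  | sq i =>
    simp only [map_mul, FreeAlgebra.lift_ι_apply, map_zero]
    apply Finsupp.lhom_ext'
    intro w
    apply LinearMap.ext_ring
    have := prod_leftMul_single (R := R) [i, i] w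
    rw [if_neg (by simp [wordProd, simple_mul_simple_self])] at this
    simpa using this
  | comm i j h =>
    have := prod_leftMul_congr (R := R) (a := [i, j]) (b := [j, i]) rfl
      (by simpa [wordProd] using simple_comm h)
    simpa using this
  | braid i h =>
    have := prod_leftMul_congr (R := R) (a := [i, i + 1, i]) (b := [i + 1, i, i + 1]) rfl
      (by simpa [wordProd, mul_assoc] using simple_braid h.ne')
    simpa [mul_assoc] using this
  | braidZero =>
    have := prod_leftMul_congr (R := R) (a := [0, 1, 0, 1]) (b := [1, 0, 1, 0]) rfl
      (by simpa [wordProd, mul_assoc] using simple_braid_zero)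
    simpa [mul_assoc] using this

variable (R) in
/-- The left regular representation of the nilCoxeter algebra, written in the basis `(u_w)`
indexed by `W_∞`. -/
noncomputable def regRep : NilCoxeter R →ₐ[R] Module.End R (SignedPerm →₀ R) :=
  RingQuot.liftAlgHom R ⟨FreeAlgebra.lift R (leftMul (R := R)), lift_leftMul_rel R⟩

/-- The coefficient `⟨ξ, w⟩` of `u_w` in the expansion of `ξ`, read off from `ξ = ξ · 1`. -/
noncomputable def coeff (w : SignedPerm) : NilCoxeter R →ₗ[R] R :=
  Finsupp.lapply w ∘ₗ LinearMap.applyₗ (Finsupp.single 1 1) ∘ₗ (regRep R).toLinearMap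

lemma regRep_gen (i : ℕ) : regRep R (gen i) = leftMul i := by
  simp [regRep, gen, RingQuot.liftAlgHom_mkAlgHom_apply]

open Classical in
/-- `⟨u_{a_1} ⋯ u_{a_ℓ}, w⟩` is `1` if `a_1 ⋯ a_ℓ` is a reduced word of `w`, and `0` otherwise. -/
theorem coeff_word (a : List ℕ) (w : SignedPerm) :
    coeff w ((a.map (gen (R := R))).prod) =
      if wordProd a = w ∧ a.length = w.length then 1 else 0 := by
  have h1 : regRep R ((a.map (gen (R := R))).prod) = (a.map (leftMul (R := R))).prod := by
    rw [map_list_prod, List.map_map]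
    congr 1
    exact List.map_congr_left fun i _ => regRep_gen i
  simp only [coeff, LinearMap.comp_apply, AlgHom.toLinearMap_apply, LinearMap.applyₗ_apply_apply,
    h1, prod_leftMul_single, mul_one, length_one, add_zero, Finsupp.lapply_apply]
  by_cases hw : wordProd a = w
  · subst hw
    by_cases hl : (wordProd a).length = a.length
    · simp [hl]
    · simp [hl, Ne.symm hl]
  · simp only [hw, false_and, if_false]
    split_ifs
    · exact Finsupp.single_eq_of_ne (Ne.symm hw)
    · rfl

/-- The factor `1 + t u_i`. -/
noncomputable def fac (t : R) (i : ℕ) : NilCoxeter R := 1 + t • gen i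

/-- `A_i(t) = (1 + t u_{n-1}) (1 + t u_{n-2}) ⋯ (1 + t u_i)`. -/
noncomputable def A (n i : ℕ) (t : R) : NilCoxeter R :=
  ((List.range' i (n - i)).reverse.map (fac t)).prod

/-- `Ã_i(t) = (1 - t u_i) (1 - t u_{i+1}) ⋯ (1 - t u_{n-1})`. -/
noncomputable def Atilde (n i : ℕ) (t : R) : NilCoxeter R :=
  ((List.range' i (n - i)).map (fac (-t))).prod

/-- `C(t) = (1 + t u_{n-1}) ⋯ (1 + t u_1) (1 + t u_0) (1 + t u_0) (1 + t u_1) ⋯ (1 + t u_{n-1})`. -/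
noncomputable def C (n : ℕ) (t : R) : NilCoxeter R :=
  ((List.range n).reverse.map (fac t)).prod * ((List.range n).map (fac t)).prod

/-- `A_1(t_1) A_1(t_2) ⋯ A_1(t_m)` for a finite alphabet `t_1, …, t_m`. As `A_1(0) = 1`, this is
the product over an infinite alphabet in which all further variables are set to zero. -/
noncomputable def prodA (n : ℕ) (T : List R) : NilCoxeter R := (T.map (A n 1)).prod

/-- `Ã_1(t_1) Ã_1(t_2) ⋯ Ã_1(t_m)` for a finite alphabet `t_1, …, t_m`. -/
noncomputable def prodAtilde (n : ℕ) (T : List R) : NilCoxeter R := (T.map (Atilde n 1)).prod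

/-- `C(t_1) C(t_2) ⋯ C(t_m)` for a finite alphabet `t_1, …, t_m`. -/
noncomputable def prodC (n : ℕ) (T : List R) : NilCoxeter R := (T.map (C n)).prod

end NilCoxeter

/-! ## Stanley functions and double Schubert polynomials -/

namespace TypeC

/-- Formal power series in `X = (x_1, x_2, …)` whose coefficients are polynomials, with integer
coefficients, in `Y = (y_1, y_2, …)` and `Z = (z_1, z_2, …)`. The index `0` is never used. -/
abbrev K : Type := MvPowerSeries ℕ (MvPolynomial (ℕ ⊕ ℕ) ℤ)

/-- The variable `x_i`. -/
noncomputable def x (i : ℕ) : K := MvPowerSeries.X i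

/-- The variable `y_i`. -/
noncomputable def y (i : ℕ) : K := MvPowerSeries.C (MvPolynomial.X (Sum.inl i))

/-- The variable `z_i`. -/
noncomputable def z (i : ℕ) : K := MvPowerSeries.C (MvPolynomial.X (Sum.inr i))

/-- The coefficient `⟨ξ C(X) η, w⟩`, where `C(X) = C(x_1) C(x_2) ⋯` is the infinite product: the
coefficient of a monomial in `x_1, …, x_N` is computed from `C(x_1) ⋯ C(x_N)`, which is legitimate
because `C(0) = 1`. -/
noncomputable def coeffCX (n : ℕ) (ξ η : NilCoxeter K) (w : SignedPerm) : K := fun d =>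
  MvPowerSeries.coeff d (NilCoxeter.coeff w
    (ξ * NilCoxeter.prodC n ((List.range' 1 (d.support.sup id)).map x) * η))

lemma exists_C_eq (n : ℕ) (t : K) : ∃ ε : NilCoxeter K, NilCoxeter.C n t = 1 + t • ε := by
  have key : ∀ l : List ℕ, ∃ ε : NilCoxeter K, (l.map (NilCoxeter.fac t)).prod = 1 + t • ε := by
    intro l
    induction l with
    | nil => exact ⟨0, by simp⟩
    | cons i l ih =>
      obtain ⟨ε, hε⟩ := ih
      refine ⟨ε + NilCoxeter.gen i + t • (NilCoxeter.gen i * ε), ?_⟩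
      rw [List.map_cons, List.prod_cons, hε, NilCoxeter.fac]
      simp only [add_mul, mul_add, one_mul, mul_one, smul_add, smul_mul_assoc, mul_smul_comm]
      abel
  obtain ⟨ε, hε⟩ := key (List.range n).reverse
  obtain ⟨δ, hδ⟩ := key (List.range n)
  refine ⟨δ + ε + t • (ε * δ), ?_⟩
  rw [NilCoxeter.C, hε, hδ]
  simp only [add_mul, mul_add, one_mul, mul_one, smul_add, smul_mul_assoc, mul_smul_comm]
  abel

/-- Any sufficiently long finite product computes the coefficients of `⟨ξ C(X) η, w⟩`. -/
theorem coeff_coeffCX (n : ℕ) (ξ η : NilCoxeter K) (w : SignedPerm) (d : ℕ →₀ ℕ) (N : ℕ)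
    (hN : d.support.sup id ≤ N) :
    MvPowerSeries.coeff d (coeffCX n ξ η w) = MvPowerSeries.coeff d (NilCoxeter.coeff w
      (ξ * NilCoxeter.prodC n ((List.range' 1 N).map x) * η)) := by
  induction N, hN using Nat.le_induction with
  | base => rfl
  | succ N hN ih =>
    rw [ih]
    obtain ⟨ε, hε⟩ := exists_C_eq n (x (1 + N))
    have h1 : NilCoxeter.prodC n ((List.range' 1 (N + 1)).map x) =
        NilCoxeter.prodC n ((List.range' 1 N).map x) * (1 + x (1 + N) • ε) := by
      rw [← hε, List.range'_concat]
      simp [NilCoxeter.prodC]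
    have hd : d (1 + N) = 0 := by
      by_contra h
      have := Finset.le_sup (f := id) (Finsupp.mem_support_iff.mpr h)
      simp only [id] at this
      omega
    have h2 : ∀ f : K, MvPowerSeries.coeff d (x (1 + N) * f) = 0 := by
      intro f
      rw [x, MvPowerSeries.X, MvPowerSeries.coeff_monomial_mul, if_neg]
      intro hle
      have := hle (1 + N)
      simp [hd] at this
    rw [h1, mul_add, mul_one, mul_add, add_mul, map_add, map_add, mul_smul_comm, mul_smul_comm,
      smul_mul_assoc, map_smul, smul_eq_mul, h2, add_zero]

/-- The type C double Schubert polynomial `𝒞𝒮_w(X; Y, Z)`, that is, the coefficient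
`⟨Ã_{n-1}(z_{n-1}) ⋯ Ã_1(z_1) C(X) A_1(y_1) ⋯ A_{n-1}(y_{n-1}), w⟩` for `w ∈ W_n`. It does not
depend on `n`, and we use the least possible `n`. -/
noncomputable def schubert (w : SignedPerm) : K :=
  coeffCX w.rank
    (((List.range' 1 (w.rank - 1)).reverse.map fun i => NilCoxeter.Atilde w.rank i (z i)).prod)
    (((List.range' 1 (w.rank - 1)).map fun i => NilCoxeter.A w.rank i (y i)).prod) w

/-- The double Stanley function `G_w(Y/Z) = ⟨Ã(Z) A(Y), w⟩` for `w ∈ S_∞`, in finite alphabets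
`Y` and `Z`. It is symmetric in `Y` and in `Z`. -/
noncomputable def stanleyG (Y Z : List K) (w : SignedPerm) : K :=
  NilCoxeter.coeff w (NilCoxeter.prodAtilde w.rank Z * NilCoxeter.prodA w.rank Y)

/-- The double mixed Stanley function `J_w(X; Y/Z) = ⟨Ã(Z) C(X) A(Y), w⟩` for `w ∈ W_∞`, in finite
alphabets `Y` and `Z`. -/
noncomputable def mixedStanleyJ (Y Z : List K) (w : SignedPerm) : K :=
  coeffCX w.rank (NilCoxeter.prodAtilde w.rank Z) (NilCoxeter.prodA w.rank Y) w

/-- `Y_j = {y_{a_{j-1}+1}, …, y_{a_j}}` for `j ≥ 1`. -/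
noncomputable def Yblock (a : ℕ → ℕ) (j : ℕ) : List K :=
  (List.range' (a (j - 1) + 1) (a j - a (j - 1))).map y

/-- `Z_j = {z_{b_{j-1}+1}, …, z_{b_j}}` for `j ≥ 1`. -/
noncomputable def Zblock (b : ℕ → ℕ) (j : ℕ) : List K :=
  (List.range' (b (j - 1) + 1) (b j - b (j - 1))).map z

/-- All descent positions of `w` are among `a_1, …, a_p`. -/
def Compatible (w : SignedPerm) (p : ℕ) (a : ℕ → ℕ) : Prop :=
  ∀ r, w.IsDescent r → ∃ i ∈ Set.Icc 1 p, a i = r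

/-- `u_1 ⋯ u_{p+q-1} = w` is a reduced factorization compatible with `a_1 < ⋯ < a_p` and
`b_1 < ⋯ < b_q`. The element `u_j` is `u k` with `j = k + 1`. -/
structure IsCompatibleFactorization (p q : ℕ) (a b : ℕ → ℕ) (w : SignedPerm)
    (u : Fin (p + q - 1) → SignedPerm) : Prop where
  prod_eq : (List.ofFn u).prod = w
  length_eq : ∑ k, (u k).length = w.length
  memS : ∀ k : Fin (p + q - 1), (k : ℕ) + 1 ≠ q → (u k).MemS
  fix_left : ∀ k : Fin (p + q - 1), (k : ℕ) + 1 < q →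
    ∀ i : ℕ, 1 ≤ i → i ≤ b (q - (k + 1)) → (u k).eval i = i
  fix_right : ∀ k : Fin (p + q - 1), q < (k : ℕ) + 1 →
    ∀ i : ℕ, 1 ≤ i → i ≤ a ((k + 1) - q) → (u k).eval i = i

/-- The factor attached to `u_j`: it is `G_{u_j}(0/Z_{q+1-j})` if `j < q`, `J_{u_q}(X; Y_1/Z_1)` if
`j = q`, and `G_{u_j}(Y_{j+1-q})` if `j > q`. -/
noncomputable def splitFactor (q : ℕ) (a b : ℕ → ℕ) (j : ℕ) (v : SignedPerm) : K :=
  if j < q then stanleyG [] (Zblock b (q + 1 - j)) v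
  else if j = q then mixedStanleyJ (Yblock a 1) (Zblock b 1) v
  else stanleyG (Yblock a (j + 1 - q)) [] v

end TypeC

/-! ### Descents and the letters of reduced words. -/

namespace SignedPerm

/-! A reduced word of `w` can end in `r` only if `r` is a descent of `w`, so right factors `1 + t
u_r` with `r` not a descent do not affect `⟨·, w⟩` (`coeff_mul_gen`). For `a_j < i ≤ a_{j+1}`, the
elements `A_{a_j+1}(y_i)` and `A_i(y_i)` differ by right factors `1 + y_i u_r` with `a_j < r < i`.
Such `r` are not descents, and `u_r` commutes with all later `A_{i'}`, whose letters are at least `i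
+ 1`. These factors can therefore be moved to the right end and dropped. Hence `A_i` may be replaced
by `A_{a_j+1}` throughout a block, and by `1` for `i > a_p` (`coeff_blocks`). Reversing words
exchanges `w` with `w⁻¹` and gives the same on the left (`coeff_blocks_left`).

The coefficient of a product is a sum over reduced factorizations (`coeff_prod_ofFn`), and each
block yields one factor. As `A_{a+1}` is the image of `A_1` under the map killing `u_1, …, u_a`, its
block has coefficient zero at `v` unless `v` lies in the parabolic subgroup generated by the `s_i`
with `i > a`; on that subgroup the coefficient is a Stanley function. This accounts for the
conditions on the `u_j`. It depends on reduced words of elements of a parabolic subgroup using only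
its letters (`IsReducedWord.letters`), which also makes coefficients independent of `n`. The
infinite product `C(X)` is handled one monomial at a time, with finitely many `x_i`. -/

lemma eval_ne_zero (w : SignedPerm) {i : ℤ} (hi : i ≠ 0) : w.eval i ≠ 0 := by
  intro h
  have h2 := w.eval_neg i
  rw [h, neg_zero, ← h] at h2
  have := w.eval_injective h2
  omega

/-- The smaller of the two consecutive nonzero integers exchanged by `s_r`; the larger one
is `r + 1`. -/
def lo (r : ℕ) : ℤ := if r = 0 then -1 else r

/-- Left multiplication by `s_i` reverses the order of two values only if it exchanges them, apart
from the pairs `{-1, k}` and the like being excluded by having no integer in between. Opposite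
values occur only for `r = 0`, which forces `i = 0` exactly then. -/
lemma simple_mul_eq_mul_simple {β : SignedPerm} {i r : ℕ} (h : β.eval (lo r) < β.eval (r + 1))
    (h' : (simple i).eval (β.eval (r + 1)) < (simple i).eval (β.eval (lo r))) :
    simple i * β = β * simple r := by
  have hx0 : β.eval (lo r) ≠ 0 := β.eval_ne_zero (by unfold lo; split_ifs <;> omega)
  have hy0 : β.eval (r + 1) ≠ 0 := β.eval_ne_zero (by omega)
  by_cases hr : r = 0
  · subst hr
    have hlo : lo 0 = -1 := rfl
    rw [hlo] at h h' hx0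
    simp only [Nat.cast_zero, zero_add, eval_neg] at h h' hx0 hy0
    have hi : i = 0 := by
      by_contra hi
      simp only [eval_simple_pos hi] at h'
      split_ifs at h' <;> omega
    subst hi
    have hβ : β.eval 1 = 1 := by
      simp only [eval_simple_zero] at h'
      split_ifs at h' <;> omega
    apply ext_pos
    intro k hk
    rw [eval_mul, eval_mul]
    by_cases h1 : k = 1
    · subst h1
      simp [hβ, eval_simple_zero_one, eval_neg]
    · rw [eval_simple_of_ne hk (by simp; omega) (by simpa using h1), eval_simple_zero, if_neg, if_neg]
      · rw [← hβ, ← eval_neg]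
        intro h2
        have := β.eval_injective h2
        omega
      · rw [← hβ]
        intro h2
        have := β.eval_injective h2
        omega
  · have hlo : lo r = r := if_neg hr
    rw [hlo] at h h' hx0
    have hne : ∀ k l : ℤ, k ≠ l → β.eval k ≠ β.eval l := fun k l hkl h2 => hkl (β.eval_injective h2)
    have hxy : β.eval r ≠ -β.eval (r + 1) := by
      rw [← eval_neg]
      exact hne _ _ (by omega)
    have hi : i ≠ 0 := by
      rintro rfl
      simp only [eval_simple_zero] at h'
      split_ifs at h' <;> omega
    have hcase : (β.eval r = i ∧ β.eval (r + 1) = i + 1) ∨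
        (β.eval r = -(i + 1) ∧ β.eval (r + 1) = -i) := by
      simp only [eval_simple_pos hi] at h'
      split_ifs at h' <;> omega
    apply ext_pos
    intro k hk
    rw [eval_mul, eval_mul]
    by_cases h1 : k = r
    · subst h1
      rw [eval_simple_self hr, eval_simple_pos hi]
      split_ifs <;> omega
    by_cases h2 : k = r + 1
    · subst h2
      rw [eval_simple_succ hr, eval_simple_pos hi]
      split_ifs <;> omega
    rw [eval_simple_of_ne hk h1 h2, eval_simple_pos hi]
    have e1 := hne k r h1
    have e2 := hne k (r + 1) h2
    have e3 := hne k (-r) (by omega)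
    have e4 := hne k (-(r + 1)) (by omega)
    rw [eval_neg] at e3 e4
    split_ifs <;> omega

/-- The exchange condition. Building the word up from the right, the inversion at `r` is absent for
the empty word, so some letter creates it; deleting that letter amounts to multiplying by `s_r` on
the right. -/
lemma exists_word_mul_simple (r : ℕ) : ∀ c : List ℕ,
    (wordProd c).eval (r + 1) < (wordProd c).eval (lo r) →
      ∃ d : List ℕ, d.length + 1 = c.length ∧ wordProd d = wordProd c * simple r := by
  intro c
  induction c with
  | nil =>
    intro h
    exfalso
    change (r : ℤ) + 1 < lo r at h
    unfold lo at h
    split_ifs at h <;> omega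
  | cons i c ih =>
    intro h
    by_cases hc : (wordProd c).eval (r + 1) < (wordProd c).eval (lo r)
    · obtain ⟨d, hd, hdc⟩ := ih hc
      exact ⟨i :: d, by simp [hd], by rw [wordProd_cons, wordProd_cons, hdc, mul_assoc]⟩
    · refine ⟨c, rfl, ?_⟩
      have hne : (wordProd c).eval (lo r) ≠ (wordProd c).eval (r + 1) := by
        intro h2
        have := (wordProd c).eval_injective h2
        unfold lo at this
        split_ifs at this <;> omega
      rw [wordProd_cons, eval_mul, eval_mul] at h
      rw [wordProd_cons, simple_mul_eq_mul_simple (by omega) h, mul_assoc, simple_mul_simple_self,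
        mul_one]

/-- A word is reduced if it is as short as possible. -/
def IsReducedWord (c : List ℕ) : Prop := c.length = (wordProd c).length

lemma IsReducedWord.of_append {c d : List ℕ} (h : IsReducedWord (c ++ d)) :
    IsReducedWord c ∧ IsReducedWord d := by
  unfold IsReducedWord at *
  rw [wordProd_append, List.length_append] at h
  have h1 := length_mul_le (wordProd c) (wordProd d)
  have h2 := length_wordProd_le c
  have h3 := length_wordProd_le d
  omega

lemma IsReducedWord.isDescent {c : List ℕ} {r : ℕ} (h : IsReducedWord (c ++ [r])) :
    (wordProd (c ++ [r])).IsDescent r := by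
  unfold IsReducedWord at h
  unfold IsDescent
  rw [← h, wordProd_append, show wordProd [r] = simple r by simp [wordProd], mul_assoc,
    simple_mul_simple_self, mul_one]
  have := length_wordProd_le c
  simp
  omega

/-- Otherwise the inversion is already present before the last letter, and the exchange condition
gives a word two letters shorter for the same element. -/
lemma IsReducedWord.eval_lt {c : List ℕ} {r : ℕ} (h : IsReducedWord (c ++ [r])) :
    (wordProd (c ++ [r])).eval (r + 1) < (wordProd (c ++ [r])).eval (lo r) := by
  by_contra hlt
  have h1 : (wordProd c).eval (r + 1) < (wordProd c).eval (lo r) := by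
    have hne : (wordProd (c ++ [r])).eval (lo r) ≠ (wordProd (c ++ [r])).eval (r + 1) := by
      intro h2
      have := (wordProd _).eval_injective h2
      unfold lo at this
      split_ifs at this <;> omega
    rw [wordProd_append, show wordProd [r] = simple r by simp [wordProd], eval_mul, eval_mul] at *
    by_cases hr : r = 0
    · subst hr
      have hlo : lo 0 = -1 := rfl
      simp only [hlo, Nat.cast_zero, zero_add, eval_simple_zero_one, eval_neg] at *
      omega
    · have hlo : lo r = r := if_neg hr
      rw [hlo] at hlt hne ⊢
      rw [eval_simple_self hr, eval_simple_succ hr] at hlt hne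
      omega
  obtain ⟨d, hd, hdc⟩ := exists_word_mul_simple r c h1
  unfold IsReducedWord at h
  rw [wordProd_append, show wordProd [r] = simple r by simp [wordProd], ← hdc] at h
  have := length_wordProd_le d
  simp at h
  omega

lemma wordProd_reverse (a : List ℕ) : wordProd a.reverse = (wordProd a)⁻¹ :=
  eq_inv_of_mul_eq_one_left (wordProd_reverse_mul a)

/-- If a set of letters generates elements of a subgroup `H`, and elements of `H` have all of their
descents in that set, then reduced words of elements of `H` use only letters of that set. -/
lemma IsReducedWord.letters {S : ℕ → Prop} {H : Subgroup SignedPerm}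
    (hS : ∀ i, S i → simple i ∈ H)
    (hH : ∀ v ∈ H, ∀ r : ℕ, v.eval (r + 1) < v.eval (lo r) → S r) :
    ∀ {c : List ℕ}, IsReducedWord c → wordProd c ∈ H → ∀ i ∈ c, S i := by
  intro c
  induction c using List.reverseRecOn with
  | nil => simp
  | append_singleton c r ih =>
    intro h hc
    have hr : S r := hH _ hc r h.eval_lt
    have hc' : wordProd c ∈ H := by
      rw [wordProd_append, show wordProd [r] = simple r by simp [wordProd]] at hc
      exact (H.mul_mem_cancel_right (hS r hr)).mp hc
    intro i hi
    rcases List.mem_append.mp hi with hi | hi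
    · exact ih h.of_append.1 hc' i hi
    · rw [List.mem_singleton.mp hi]
      exact hr

lemma wordProd_mem {H : Subgroup SignedPerm} {c : List ℕ} (h : ∀ i ∈ c, simple i ∈ H) :
    wordProd c ∈ H := by
  apply H.list_prod_mem
  simpa using h

lemma eval_inv_eq_iff {w : SignedPerm} {i j : ℤ} : w⁻¹.eval i = j ↔ i = w.eval j := by
  constructor
  · rintro rfl
    rw [← eval_mul, mul_inv_cancel, eval_one]
  · rintro rfl
    rw [← eval_mul, inv_mul_cancel, eval_one]

/-- `W_n` as a subgroup of `W_∞`. -/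
def subgroupW (n : ℕ) : Subgroup SignedPerm where
  carrier := {w | w.MemW n}
  one_mem' := fun _ _ => rfl
  mul_mem' := fun {v w} hv hw i hi => by rw [eval_mul, hw i hi, hv i hi]
  inv_mem' := fun {w} hw i hi => by rw [eval_inv_eq_iff, hw i hi]

/-- The subgroup of the `w ∈ S_∞` that fix `1, …, a`. -/
def subgroupS (a : ℕ) : Subgroup SignedPerm where
  carrier := {w | w.MemS ∧ ∀ i : ℕ, 1 ≤ i → i ≤ a → w.eval i = i}
  one_mem' := ⟨fun _ hi => hi, fun _ _ _ => rfl⟩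
  mul_mem' := fun {v w} hv hw => ⟨fun i hi => hv.1 _ (hw.1 i hi), fun i h1 h2 => by
    rw [eval_mul, hw.2 i h1 h2, hv.2 i h1 h2]⟩
  inv_mem' := fun {w} hw => ⟨fun i hi => by
      by_contra h
      have h1 : i = w.eval (w⁻¹.eval i) := eval_inv_eq_iff.mp rfl
      rcases eq_or_ne (w⁻¹.eval i) 0 with h0 | h0
      · exact eval_ne_zero _ hi.ne' h0
      · have := hw.1 (-(w⁻¹.eval i)) (by omega)
        rw [eval_neg, ← h1] at this
        omega,
    fun i h1 h2 => by rw [eval_inv_eq_iff, hw.2 i h1 h2]⟩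

lemma simple_mem_subgroupW {n i : ℕ} (h : i < n) : simple i ∈ subgroupW n :=
  fun _ hj => eval_simple_of_ne (by omega) (by omega) (by omega)

lemma simple_mem_subgroupS {a i : ℕ} (h : a < i) : simple i ∈ subgroupS a := by
  refine ⟨fun j hj => ?_, fun j h1 h2 => eval_simple_of_ne (by omega) (by omega) (by omega)⟩
  rw [eval_simple_pos (by omega)]
  split_ifs <;> omega

/-- For `r ≥ n`, an element of `W_n` fixes `r + 1` and preserves the interval from `-(r + 1)` to `r
+ 1`, so it has no inversion at `r`. -/
lemma IsReducedWord.lt_of_memW {n : ℕ} {c : List ℕ} (h : IsReducedWord c)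
    (hc : (wordProd c).MemW n) : ∀ i ∈ c, i < n := by
  refine h.letters (S := fun i => i < n) (H := subgroupW n) (fun i => simple_mem_subgroupW) ?_ hc
  intro v hv r hr
  by_contra hrn
  have h1 : v.eval (r + 1) = r + 1 := hv _ (by omega)
  have h2 : |lo r| ≤ (r + 1 : ℕ) := by
    rw [abs_le]
    unfold lo
    split_ifs <;> omega
  have h3 := abs_eval_le (n := r + 1) (w := v) (fun i hi => hv i (by push_cast at hi; omega)) h2
  rw [abs_le] at h3
  push_cast at h3
  omega

lemma IsReducedWord.gt_of_mem_subgroupS {a : ℕ} {c : List ℕ} (h : IsReducedWord c)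
    (hc : wordProd c ∈ subgroupS a) : ∀ i ∈ c, a < i := by
  refine h.letters (S := fun i => a < i) (fun i => simple_mem_subgroupS) ?_ hc
  intro v hv r hr
  by_contra hra
  have h1 := hv.1 (r + 1) (by omega)
  by_cases hr0 : r = 0
  · subst hr0
    have hlo : lo 0 = -1 := rfl
    rw [hlo, eval_neg] at hr
    simp only [Nat.cast_zero, zero_add] at hr h1
    omega
  · have hlo : lo r = r := if_neg hr0
    rw [hlo, hv.2 r (by omega) (by omega)] at hr
    -- An inversion at `r ≤ a` would give `r + 1` a positive value below `r`, but that value is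
    -- already taken by a fixed point.
    obtain ⟨m, hm⟩ : ∃ m : ℕ, v.eval (r + 1) = m := ⟨(v.eval (r + 1)).toNat, by omega⟩
    have h2 := hv.2 m (by omega) (by omega)
    rw [← hm] at h2
    have := v.eval_injective h2
    omega

lemma memW_rank (w : SignedPerm) : w.MemW w.rank := Nat.sInf_mem w.exists_memW

lemma rank_le {w : SignedPerm} {n : ℕ} (h : w.MemW n) : w.rank ≤ n := Nat.sInf_le h

lemma length_inv (w : SignedPerm) : w⁻¹.length = w.length := by
  have key : ∀ v : SignedPerm, v⁻¹.length ≤ v.length := by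
    intro v
    obtain ⟨a, ha, rfl⟩ := v.exists_reduced_word
    rw [← wordProd_reverse, ← ha, ← List.length_reverse]
    exact length_wordProd_le _
  exact le_antisymm (key w) (by simpa using key w⁻¹)

end SignedPerm
-- Coefficients of products in the nilCoxeter algebra.
namespace NilCoxeter

open SignedPerm

variable {R : Type*} [CommRing R]

/-- The monomial `u_{c_1} ⋯ u_{c_ℓ}` of a word `c_1 ⋯ c_ℓ`. -/
noncomputable def word (R : Type*) [CommRing R] (c : List ℕ) : NilCoxeter R := (c.map gen).prod

lemma word_append (c d : List ℕ) : word R (c ++ d) = word R c * word R d := by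
  simp [word]

lemma word_singleton (i : ℕ) : word R [i] = gen i := by simp [word]

open Classical in
lemma coeff_word' (c : List ℕ) (w : SignedPerm) :
    coeff w (word R c) = if wordProd c = w ∧ IsReducedWord c then 1 else 0 := by
  rw [word, coeff_word]
  congr 1
  rw [eq_iff_iff]
  unfold IsReducedWord
  constructor
  · rintro ⟨rfl, h⟩
    exact ⟨rfl, h⟩
  · rintro ⟨rfl, h⟩
    exact ⟨rfl, h⟩

lemma span_word : Submodule.span R (Set.range (word R)) = ⊤ := by
  rw [eq_top_iff]
  rintro ξ -
  obtain ⟨f, rfl⟩ := RingQuot.mkAlgHom_surjective R (Rel R) ξ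
  have hmul : ∀ x ∈ Submodule.span R (Set.range (word R)),
      ∀ y ∈ Submodule.span R (Set.range (word R)), x * y ∈ Submodule.span R (Set.range (word R)) := by
    intro x hx y hy
    have h := Submodule.mul_mem_mul hx hy
    rw [Submodule.span_mul_span] at h
    refine Submodule.span_mono ?_ h
    rintro _ ⟨_, ⟨c, rfl⟩, _, ⟨d, rfl⟩, rfl⟩
    exact ⟨c ++ d, word_append c d⟩
  induction f using FreeAlgebra.induction with
  | grade0 r =>
    rw [AlgHom.commutes, Algebra.algebraMap_eq_smul_one]
    exact Submodule.smul_mem _ _ (Submodule.subset_span ⟨[], by simp [word]⟩)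
  | grade1 i => exact Submodule.subset_span ⟨[i], word_singleton i⟩
  | mul f g hf hg =>
    rw [map_mul]
    exact hmul _ hf _ hg
  | add f g hf hg =>
    rw [map_add]
    exact add_mem hf hg

lemma linearMap_ext {M : Type*} [AddCommMonoid M] [Module R M] {f g : NilCoxeter R →ₗ[R] M}
    (h : ∀ c, f (word R c) = g (word R c)) (ξ : NilCoxeter R) : f ξ = g ξ := by
  have := LinearMap.ext_on_range span_word h
  rw [this]

/-- The tuples `(u_1, …, u_m)` with `u_1 ⋯ u_m = w` and `ℓ(u_1) + ⋯ + ℓ(u_m) = ℓ(w)`. -/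
def reducedFactorizations (m : ℕ) (w : SignedPerm) : Set (Fin m → SignedPerm) :=
  {u | (List.ofFn u).prod = w ∧ ∑ k, (u k).length = w.length}

lemma wordProd_flatten_ofFn {m : ℕ} (c : Fin m → List ℕ) :
    wordProd (List.ofFn c).flatten = (List.ofFn fun k => wordProd (c k)).prod := by
  induction m with
  | zero => simp [wordProd]
  | succ m ih => simp [wordProd_append, ih]

lemma length_flatten_ofFn {m : ℕ} (c : Fin m → List ℕ) :
    (List.ofFn c).flatten.length = ∑ k, (c k).length := by
  induction m with
  | zero => simp
  | succ m ih => simp [Fin.sum_univ_succ, ih]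

lemma word_flatten_ofFn {m : ℕ} (c : Fin m → List ℕ) :
    word R (List.ofFn c).flatten = (List.ofFn fun k => word R (c k)).prod := by
  induction m with
  | zero => simp [word]
  | succ m ih => simp [word_append, ih]

/-- The factors of a reduced factorization of `w ∈ W_n` lie in `W_n`. -/
lemma memW_of_mem_reducedFactorizations {m n : ℕ} {w : SignedPerm} (hw : w.MemW n)
    {u : Fin m → SignedPerm} (hu : u ∈ reducedFactorizations m w) (k : Fin m) : (u k).MemW n := by
  choose c hcl hc using fun k => (u k).exists_reduced_word
  have h1 : wordProd (List.ofFn c).flatten = w := by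
    rw [wordProd_flatten_ofFn]
    simp only [hc]
    exact hu.1
  -- Since the lengths add up, concatenating reduced words of the factors gives a reduced word of
  -- `w`.
  have h2 : IsReducedWord (List.ofFn c).flatten := by
    unfold IsReducedWord
    rw [h1, length_flatten_ofFn, ← hu.2]
    simp only [hcl]
  have h3 := h2.lt_of_memW (n := n) (h1 ▸ hw)
  rw [← hc k]
  refine wordProd_mem (H := subgroupW n) fun i hi => simple_mem_subgroupW (h3 i ?_)
  rw [List.mem_flatten]
  exact ⟨c k, by simp, hi⟩

/-- With `w ∈ W_n`, every factor is the product of a word of length at most `ℓ(w)` in the `n`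
letters `0, …, n - 1`. -/
lemma finite_reducedFactorizations (m : ℕ) (w : SignedPerm) :
    (reducedFactorizations m w).Finite := by
  obtain ⟨n, hn⟩ := w.exists_memW
  have hF : {v : SignedPerm | v.MemW n ∧ v.length ≤ w.length}.Finite := by
    have hl := List.finite_length_le (Fin n) w.length
    refine (hl.image fun c => wordProd (c.map Fin.val)).subset ?_
    rintro v ⟨hv, hvl⟩
    obtain ⟨c, hc, rfl⟩ := v.exists_reduced_word
    have hlt := IsReducedWord.lt_of_memW (c := c) hc hv
    refine ⟨c.pmap (fun i hi => ⟨i, hi⟩) hlt, ?_, ?_⟩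
    · simp only [Set.mem_ofPred_eq, List.length_pmap]
      omega
    · simp [List.map_pmap]
  refine (Set.Finite.pi' fun _ : Fin m => hF).subset fun u hu k => ?_
  refine ⟨memW_of_mem_reducedFactorizations hn hu k, ?_⟩
  rw [← hu.2]
  exact Finset.single_le_sum (f := fun k => (u k).length) (fun _ _ => Nat.zero_le _)
    (Finset.mem_univ k)

open Classical in
/-- The coefficients of a product are sums over reduced factorizations. -/
theorem coeff_prod_ofFn {m : ℕ} (w : SignedPerm) (ξ : Fin m → NilCoxeter R) :
    coeff w (List.ofFn ξ).prod =
      ∑ u ∈ (finite_reducedFactorizations m w).toFinset, ∏ k, coeff (u k) (ξ k) := by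
  let f : MultilinearMap R (fun _ : Fin m => NilCoxeter R) R :=
    (coeff w).compMultilinearMap (MultilinearMap.mkPiAlgebraFin R m (NilCoxeter R))
  let g : MultilinearMap R (fun _ : Fin m => NilCoxeter R) R :=
    ∑ u ∈ (finite_reducedFactorizations m w).toFinset,
      (MultilinearMap.mkPiAlgebra R (Fin m) R).compLinearMap fun k => coeff (u k)
  -- Both sides are multilinear, so it is enough to test monomials. Monomials are only known to
  -- span, so the identity is pulled back to the free module on words, where they form a basis.
  let L : (List ℕ →₀ R) →ₗ[R] NilCoxeter R := Finsupp.linearCombination R (word R)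
  have hL : Function.Surjective L := by
    rw [← LinearMap.range_eq_top, Finsupp.range_linearCombination, span_word]
  have hfg : f.compLinearMap (fun _ => L) = g.compLinearMap (fun _ => L) := by
    refine Module.Basis.ext_multilinear (fun _ => Finsupp.basisSingleOne) fun c => ?_
    have e1 : ∀ c, L (Finsupp.basisSingleOne c) = word R c := fun c => by simp [L]
    simp only [MultilinearMap.compLinearMap_apply, e1, f, g, LinearMap.compMultilinearMap_apply,
      MultilinearMap.mkPiAlgebraFin_apply, sum_apply,
      MultilinearMap.mkPiAlgebra_apply]
    rw [← word_flatten_ofFn, coeff_word', wordProd_flatten_ofFn]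
    simp only [coeff_word']
    -- For monomials, at most one tuple `u` contributes, namely that of the products of the given
    -- words.
    have e2 : ∀ u : Fin m → SignedPerm,
        (∏ k, if wordProd (c k) = u k ∧ IsReducedWord (c k) then (1 : R) else 0) =
          if (fun k => wordProd (c k)) = u then
            if ∀ k, IsReducedWord (c k) then 1 else 0 else 0 := by
      intro u
      rw [Finset.prod_ite_zero]
      simp only [Finset.mem_univ, true_implies, Finset.prod_const_one, funext_iff]
      simp only [← ite_and, forall_and]
    simp only [e2, Finset.sum_ite_eq, Set.Finite.mem_toFinset]
    rw [← ite_and]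
    congr 1
    rw [eq_iff_iff]
    -- A concatenation is reduced exactly when each piece is reduced and the lengths of the products
    -- add up.
    constructor
    · rintro ⟨h1, h2⟩
      have h3 : ∀ k, IsReducedWord (c k) := by
        intro k
        have hk : c k ∈ List.ofFn c := by simp
        obtain ⟨s, t, hst⟩ := List.append_of_mem hk
        rw [hst, List.flatten_append, List.flatten_cons] at h2
        exact h2.of_append.2.of_append.1
      refine ⟨⟨h1, ?_⟩, h3⟩
      unfold IsReducedWord at h2 h3
      rw [wordProd_flatten_ofFn, h1, length_flatten_ofFn] at h2
      rw [← h2]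
      simp only [h3]
    · rintro ⟨h12, h3⟩
      obtain ⟨h1, h2⟩ := h12
      refine ⟨h1, ?_⟩
      unfold IsReducedWord at h3 ⊢
      rw [wordProd_flatten_ofFn, h1, length_flatten_ofFn, ← h2]
      simp only [h3]
  choose ξ' hξ' using fun k => hL (ξ k)
  have := congrArg (fun F => F ξ') hfg
  simpa [f, g, hξ'] using this

/-! ### Restriction to a set of letters -/

open Classical in
/-- The algebra endomorphism that kills the generators `u_i` with `i ∉ S`. -/
noncomputable def proj (S : ℕ → Prop) : NilCoxeter R →ₐ[R] NilCoxeter R :=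
  RingQuot.liftAlgHom R ⟨FreeAlgebra.lift R fun i => if S i then gen i else 0, by
    have key : ∀ ⦃f g⦄, Rel R f g → RingQuot.mkAlgHom R (Rel R) f = RingQuot.mkAlgHom R (Rel R) g :=
      fun _ _ h => RingQuot.mkAlgHom_rel R h
    intro f g h
    have h' := key h
    -- The two sides of each commutation or braid relation involve the same letters, so they survive
    -- together or vanish together.
    cases h with
    | sq i =>
      simp only [map_mul, map_zero, FreeAlgebra.lift_ι_apply] at h' ⊢
      split_ifs <;> simp_all [gen]
    | comm i j hij =>
      simp only [map_mul, FreeAlgebra.lift_ι_apply] at h' ⊢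
      split_ifs <;> simp_all [gen]
    | braid i hi =>
      simp only [map_mul, FreeAlgebra.lift_ι_apply] at h' ⊢
      split_ifs <;> simp_all [gen]
    | braidZero =>
      simp only [map_mul, FreeAlgebra.lift_ι_apply] at h' ⊢
      split_ifs <;> simp_all [gen]⟩

open Classical in
lemma proj_gen (S : ℕ → Prop) (i : ℕ) : proj (R := R) S (gen i) = if S i then gen i else 0 := by
  simp [proj, gen, RingQuot.liftAlgHom_mkAlgHom_apply]

open Classical in
lemma proj_word (S : ℕ → Prop) (c : List ℕ) :
    proj S (word R c) = if ∀ i ∈ c, S i then word R c else 0 := by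
  induction c with
  | nil => simp [word]
  | cons i c ih =>
    rw [show i :: c = [i] ++ c from rfl, word_append, map_mul, ih, word_singleton, proj_gen]
    by_cases h1 : S i <;> by_cases h2 : ∀ j ∈ c, S j <;> simp [h1, h2]

open Classical in
lemma proj_fac (S : ℕ → Prop) (t : R) (i : ℕ) :
    proj S (fac t i) = if S i then fac t i else 1 := by
  rw [fac, map_add, map_one, map_smul, proj_gen]
  split_ifs <;> simp

lemma proj_fac_of_pos {S : ℕ → Prop} {t : R} {i : ℕ} (h : S i) : proj S (fac t i) = fac t i := by
  rw [proj_fac, if_pos h]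

lemma proj_fac_of_neg {S : ℕ → Prop} {t : R} {i : ℕ} (h : ¬ S i) : proj S (fac t i) = 1 := by
  rw [proj_fac, if_neg h]

/-- The projection kills only monomials containing a letter outside `S`, and none of these is a
reduced word of `v`. -/
lemma coeff_proj {S : ℕ → Prop} {v : SignedPerm}
    (h : ∀ c, IsReducedWord c → wordProd c = v → ∀ i ∈ c, S i) (ξ : NilCoxeter R) :
    coeff v (proj S ξ) = coeff v ξ := by
  classical
  refine linearMap_ext (f := coeff v ∘ₗ (proj S).toLinearMap) (g := coeff v) (fun c => ?_) ξ
  simp only [LinearMap.comp_apply, AlgHom.toLinearMap_apply, proj_word]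
  split_ifs with hc
  · rfl
  · rw [map_zero, coeff_word', if_neg]
    exact fun h2 => hc (h c h2.2 h2.1)

lemma coeff_proj_eq_zero {S : ℕ → Prop} {v : SignedPerm}
    (h : ∀ c, wordProd c = v → ¬ ∀ i ∈ c, S i) (ξ : NilCoxeter R) :
    coeff v (proj S ξ) = 0 := by
  classical
  refine linearMap_ext (f := coeff v ∘ₗ (proj S).toLinearMap) (g := 0) (fun c => ?_) ξ
  simp only [LinearMap.comp_apply, AlgHom.toLinearMap_apply, proj_word, LinearMap.zero_apply]
  split_ifs with hc
  · rw [coeff_word', if_neg]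
    exact fun h2 => h c h2.1 hc
  · rw [map_zero]

/-- A monomial of `ξ * gen r` contributing to `w` would be a reduced word of `w` ending in `r`,
making `r` a descent. -/
lemma coeff_mul_gen {w : SignedPerm} {r : ℕ} (h : ¬ w.IsDescent r) (ξ : NilCoxeter R) :
    coeff w (ξ * gen r) = 0 := by
  classical
  refine linearMap_ext (f := coeff w ∘ₗ LinearMap.mulRight R (gen r)) (g := 0) (fun c => ?_) ξ
  simp only [LinearMap.comp_apply, LinearMap.mulRight_apply, LinearMap.zero_apply]
  rw [← word_singleton, ← word_append, coeff_word', if_neg]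
  rintro ⟨rfl, h2⟩
  exact h h2.isDescent

/-- The anti-automorphism of the nilCoxeter algebra that fixes the generators. -/
noncomputable def revHom : NilCoxeter R →ₐ[R] (NilCoxeter R)ᵐᵒᵖ :=
  RingQuot.liftAlgHom R ⟨FreeAlgebra.lift R fun i => MulOpposite.op (gen i), by
    have key : ∀ ⦃f g⦄, Rel R f g → RingQuot.mkAlgHom R (Rel R) f = RingQuot.mkAlgHom R (Rel R) g :=
      fun _ _ h => RingQuot.mkAlgHom_rel R h
    intro f g h
    have h' := key h
    cases h with
    | sq i =>
      simp only [map_mul, map_zero, FreeAlgebra.lift_ι_apply] at h' ⊢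
      rw [← MulOpposite.op_mul, gen, h', MulOpposite.op_zero]
    | comm i j hij =>
      simp only [map_mul, FreeAlgebra.lift_ι_apply] at h' ⊢
      simp only [← MulOpposite.op_mul, gen, h']
    | braid i hi =>
      simp only [map_mul, FreeAlgebra.lift_ι_apply] at h' ⊢
      simp only [← MulOpposite.op_mul, gen, ← mul_assoc, h']
    | braidZero =>
      simp only [map_mul, FreeAlgebra.lift_ι_apply] at h' ⊢
      simp only [← MulOpposite.op_mul, gen, ← mul_assoc, h']⟩

/-- The reversal `u_{c_1} ⋯ u_{c_ℓ} ↦ u_{c_ℓ} ⋯ u_{c_1}`. -/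
noncomputable def rev (ξ : NilCoxeter R) : NilCoxeter R := (revHom ξ).unop

lemma rev_mul (ξ η : NilCoxeter R) : rev (ξ * η) = rev η * rev ξ := by simp [rev]

lemma rev_one : rev (1 : NilCoxeter R) = 1 := by simp [rev]

lemma rev_gen (i : ℕ) : rev (gen (R := R) i) = gen i := by
  simp [rev, revHom, gen, RingQuot.liftAlgHom_mkAlgHom_apply]

lemma rev_fac (t : R) (i : ℕ) : rev (fac t i) = fac t i := by
  have : rev (fac t i) = 1 + t • rev (gen (R := R) i) := by simp [rev, fac]
  rw [this, rev_gen, fac]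

lemma rev_list_prod (l : List (NilCoxeter R)) : rev l.prod = (l.map rev).reverse.prod := by
  induction l with
  | nil => simp [rev_one]
  | cons a l ih => simp [rev_mul, ih]

lemma rev_word (c : List ℕ) : rev (word R c) = word R c.reverse := by
  rw [word, rev_list_prod, List.map_map, word, List.map_reverse]
  congr 3
  funext i
  exact rev_gen i

/-- Reversal matches reduced words of `w` with those of `w⁻¹`; this transfers statements about right
factors to left factors. -/
lemma coeff_rev (w : SignedPerm) (ξ : NilCoxeter R) : coeff w⁻¹ (rev ξ) = coeff w ξ := by
  classical
  refine linearMap_ext (f := coeff w⁻¹ ∘ₗ (MulOpposite.opLinearEquiv R).symm.toLinearMap ∘ₗ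
    (revHom (R := R)).toLinearMap) (g := coeff w) (fun c => ?_) ξ
  change coeff w⁻¹ (rev (word R c)) = _
  rw [rev_word, coeff_word', coeff_word']
  unfold IsReducedWord
  simp only [wordProd_reverse, inv_inj, length_inv, List.length_reverse]
  congr

lemma rev_rev (ξ : NilCoxeter R) : rev (rev ξ) = ξ := by
  refine linearMap_ext (f := ((MulOpposite.opLinearEquiv R).symm.toLinearMap ∘ₗ
    (revHom (R := R)).toLinearMap) ∘ₗ (MulOpposite.opLinearEquiv R).symm.toLinearMap ∘ₗ
    (revHom (R := R)).toLinearMap) (g := LinearMap.id) (fun c => ?_) ξ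
  change rev (rev (word R c)) = word R c
  rw [rev_word, rev_word, List.reverse_reverse]

end NilCoxeter
-- Commutation and truncation of the factors `A`, `Atilde` and `C`.
namespace NilCoxeter

open SignedPerm

variable {R : Type*} [CommRing R]

lemma gen_mul_gen_self (i : ℕ) : gen (R := R) i * gen i = 0 := by
  simpa [gen] using RingQuot.mkAlgHom_rel R (Rel.sq (R := R) i)

lemma gen_comm {i j : ℕ} (h : i + 2 ≤ j) : Commute (gen (R := R) i) (gen j) := by
  simpa [gen, Commute, SemiconjBy] using RingQuot.mkAlgHom_rel R (Rel.comm (R := R) i j h)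

lemma gen_braid {i : ℕ} (h : 0 < i) :
    gen (R := R) i * gen (i + 1) * gen i = gen (i + 1) * gen i * gen (i + 1) := by
  simpa [gen] using RingQuot.mkAlgHom_rel R (Rel.braid (R := R) i h)

lemma commute_gen_fac {i j : ℕ} (t : R) (h : i + 2 ≤ j) : Commute (gen i) (fac t j) :=
  (Commute.one_right _).add_right ((gen_comm h).smul_right t)

lemma commute_fac {ξ : NilCoxeter R} {r : ℕ} (t : R) (h : Commute (gen r) ξ) :
    Commute (fac t r) ξ :=
  (Commute.one_left _).add_left (h.smul_left t)

/-- The letters decrease from left to right, so those below `k` form a right factor. The `min`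
covers `k > n`, where `A n k t` is `1`. -/
lemma A_eq_mul {n s k : ℕ} (h : s ≤ k) (t : R) :
    A n s t = A n k t * ((List.range' s (min k n - s)).reverse.map (fac t)).prod := by
  rw [A, A, ← List.prod_append, ← List.map_append, ← List.reverse_append]
  congr 3
  rcases le_total n k with hn | hn
  · rw [min_eq_right hn, Nat.sub_eq_zero_of_le hn]
    simp
  · rw [min_eq_left hn]
    have := List.range'_append_1 (s := s) (m := k - s) (n := n - k)
    rw [show s + (k - s) = k by omega, show k - s + (n - k) = n - s by omega] at this
    exact this.symm

lemma A_of_le {n i : ℕ} (h : n ≤ i) (t : R) : A n i t = 1 := by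
  rw [A, Nat.sub_eq_zero_of_le h]
  simp

lemma A_succ {n i : ℕ} (h : i < n) (t : R) : A n i t = A n (i + 1) t * fac t i := by
  rw [A_eq_mul (Nat.le_succ i), show min (i + 1) n - i = 1 by omega]
  simp

lemma commute_gen_A {n r i : ℕ} (h : r + 2 ≤ i) (t : R) : Commute (gen r) (A n i t) := by
  refine Commute.list_prod_right _ _ fun ξ hξ => ?_
  obtain ⟨j, hj, rfl⟩ := List.mem_map.mp hξ
  rw [List.mem_reverse, List.mem_range'_1] at hj
  exact commute_gen_fac t (by omega)

lemma fac_mul_fac (s t : R) (i : ℕ) : fac s i * fac t i = fac (s + t) i := by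
  simp only [fac, mul_add, add_mul, mul_one, one_mul, smul_mul_smul_comm, gen_mul_gen_self]
  module

lemma fac_mul_fac_neg (t : R) (i : ℕ) : fac t i * fac (-t) i = 1 := by
  rw [fac_mul_fac, add_neg_cancel, fac, zero_smul, add_zero]

/-- The point of this form is that the right-hand side is symmetric in `s` and `t`. -/
lemma yangBaxter {i : ℕ} (hi : 0 < i) (s t : R) :
    fac (-t) (i + 1) * fac s i * fac t (i + 1) * fac t i =
      1 + (s + t) • gen i + (s * t) • (gen i * gen (i + 1) - gen (i + 1) * gen i) := by
  have h1 := gen_mul_gen_self (R := R) i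
  have h2 := gen_mul_gen_self (R := R) (i + 1)
  have h3 := gen_braid (R := R) hi
  simp only [fac]
  generalize gen (R := R) i = b at *
  generalize gen (R := R) (i + 1) = a at *
  have h4 : a * b * b = 0 := by rw [mul_assoc, h1, mul_zero]
  have h5 : b * a * b * b = 0 := by rw [mul_assoc, h1, mul_zero]
  simp only [mul_add, add_mul, mul_one, one_mul, smul_mul_assoc, mul_smul_comm, smul_smul,
    h1, h2, h4, ← h3, h5, zero_mul, smul_zero, smul_add, smul_sub]
  module

/-- Descending induction on `i`: the product is `A n (i + 1) s * A n (i + 1) t` times the symmetric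
expression of `yangBaxter`. Positivity of `i` is needed for the braid relation of length three. -/
lemma commute_A {n i : ℕ} (hi : 0 < i) (s t : R) : Commute (A n i s) (A n i t) := by
  obtain ⟨d, hd⟩ : ∃ d, n - i = d := ⟨_, rfl⟩
  induction d generalizing i with
  | zero =>
    rw [A_of_le (by omega)]
    exact Commute.one_left _
  | succ d ih =>
    by_cases h : i + 1 = n
    · subst h
      rw [A_succ (Nat.lt_succ_self i), A_succ (Nat.lt_succ_self i), A_of_le le_rfl, A_of_le le_rfl,
        one_mul, one_mul, Commute, SemiconjBy, fac_mul_fac, fac_mul_fac, add_comm]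
    have key : ∀ s t : R, A n i s * A n i t = A n (i + 1) s * A n (i + 1) t *
        (fac (-t) (i + 1) * fac s i * fac t (i + 1) * fac t i) := by
      intro s t
      -- The factor `1 - t u_{i+1}` is inverse to `1 + t u_{i+1}`, and reinserting it completes `A n
      -- (i + 1) t`.
      have h2 : A n (i + 2) t = A n (i + 1) t * fac (-t) (i + 1) := by
        rw [A_succ (n := n) (i := i + 1) (by omega), mul_assoc, fac_mul_fac_neg, mul_one]
      have h3 : fac s i * A n (i + 2) t = A n (i + 2) t * fac s i :=
        commute_fac s (commute_gen_A le_rfl t)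
      calc A n i s * A n i t
          = A n (i + 1) s * (fac s i * A n (i + 2) t) * fac t (i + 1) * fac t i := by
            rw [A_succ (n := n) (i := i) (by omega) s, A_succ (n := n) (i := i) (by omega) t,
              A_succ (n := n) (i := i + 1) (by omega) t]
            simp only [mul_assoc]
        _ = _ := by
            rw [h3, h2]
            simp only [mul_assoc]
    rw [Commute, SemiconjBy, key, key, yangBaxter hi, yangBaxter hi,
      (ih (i := i + 1) (by omega) (by omega)).eq, add_comm s, mul_comm s]

lemma rev_A (n i : ℕ) (t : R) : rev (A n i t) = Atilde n i (-t) := by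
  rw [A, rev_list_prod, List.map_map, Atilde, neg_neg, List.map_reverse, List.reverse_reverse]
  congr 2
  funext j
  exact rev_fac t j

lemma C_eq (n : ℕ) (t : R) : C n t = A n 0 t * rev (A n 0 t) := by
  rw [rev_A, A, Atilde, C, neg_neg, Nat.sub_zero, List.range_eq_range']

lemma proj_rev (S : ℕ → Prop) (ξ : NilCoxeter R) : proj S (rev ξ) = rev (proj S ξ) := by
  classical
  refine linearMap_ext (f := (proj S).toLinearMap ∘ₗ
    (MulOpposite.opLinearEquiv R).symm.toLinearMap ∘ₗ (revHom (R := R)).toLinearMap)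
    (g := ((MulOpposite.opLinearEquiv R).symm.toLinearMap ∘ₗ (revHom (R := R)).toLinearMap) ∘ₗ
      (proj S).toLinearMap) (fun c => ?_) ξ
  change proj S (rev (word R c)) = rev (proj S (word R c))
  rw [rev_word, proj_word, proj_word]
  simp only [List.mem_reverse]
  split_ifs
  · rw [rev_word]
  · simp [rev]

lemma proj_prod_fac_of_pos {S : ℕ → Prop} {l : List ℕ} (h : ∀ i ∈ l, S i) (t : R) :
    proj S (l.map (fac t)).prod = (l.map (fac t)).prod := by
  rw [map_list_prod, List.map_map]
  congr 1
  exact List.map_congr_left fun i hi => proj_fac_of_pos (h i hi)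

lemma proj_prod_fac_of_neg {S : ℕ → Prop} {l : List ℕ} (h : ∀ i ∈ l, ¬ S i) (t : R) :
    proj S (l.map (fac t)).prod = 1 := by
  rw [map_list_prod, List.map_map]
  apply List.prod_eq_one
  intro ξ hξ
  obtain ⟨i, hi, rfl⟩ := List.mem_map.mp hξ
  exact proj_fac_of_neg (h i hi)

/-- Passing from `n` to a smaller `m` is killing letters; this is the source of independence of `n`.
-/
lemma proj_lt_A {m n : ℕ} (h : m ≤ n) (i : ℕ) (t : R) :
    proj (fun j => j < m) (A n i t) = A m i t := by
  have hl : List.range' i (n - i) =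
      List.range' i (m - i) ++ List.range' (i + (m - i)) (n - i - (m - i)) := by
    rw [List.range'_append_1]
    congr 1
    omega
  rw [A, hl, List.reverse_append, List.map_append, List.prod_append, map_mul,
    proj_prod_fac_of_neg, proj_prod_fac_of_pos, one_mul, A]
  · intro j hj
    rw [List.mem_reverse, List.mem_range'_1] at hj
    omega
  · intro j hj
    rw [List.mem_reverse, List.mem_range'_1] at hj
    omega

lemma proj_gt_A (n a : ℕ) (t : R) : proj (fun j => a < j) (A n 1 t) = A n (a + 1) t := by
  rw [A_eq_mul (show 1 ≤ a + 1 by omega), map_mul, proj_prod_fac_of_neg, mul_one, A,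
    proj_prod_fac_of_pos]
  · intro j hj
    rw [List.mem_reverse, List.mem_range'_1] at hj
    omega
  · intro j hj
    rw [List.mem_reverse, List.mem_range'_1] at hj
    omega

lemma Atilde_eq_rev (n i : ℕ) (t : R) : Atilde n i t = rev (A n i (-t)) := by
  rw [rev_A, neg_neg]

lemma proj_lt_Atilde {m n : ℕ} (h : m ≤ n) (i : ℕ) (t : R) :
    proj (fun j => j < m) (Atilde n i t) = Atilde m i t := by
  rw [Atilde_eq_rev, proj_rev, proj_lt_A h, Atilde_eq_rev]

lemma proj_gt_Atilde (n a : ℕ) (t : R) :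
    proj (fun j => a < j) (Atilde n 1 t) = Atilde n (a + 1) t := by
  rw [Atilde_eq_rev, proj_rev, proj_gt_A, Atilde_eq_rev]

lemma proj_lt_C {m n : ℕ} (h : m ≤ n) (t : R) : proj (fun j => j < m) (C n t) = C m t := by
  rw [C_eq, map_mul, proj_rev, proj_lt_A h, C_eq]

lemma commute_Atilde {n i : ℕ} (hi : 0 < i) (s t : R) :
    Commute (Atilde n i s) (Atilde n i t) := by
  rw [Atilde_eq_rev, Atilde_eq_rev, Commute, SemiconjBy, ← rev_mul, ← rev_mul,
    (commute_A hi _ _).eq]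

/-! ### Coefficients at elements with prescribed descents -/

lemma coeff_mul_prod_fac {w : SignedPerm} {l : List ℕ} (h : ∀ r ∈ l, ¬ w.IsDescent r) (t : R)
    (ξ : NilCoxeter R) : coeff w (ξ * (l.map (fac t)).prod) = coeff w ξ := by
  induction l using List.reverseRecOn with
  | nil => simp
  | append_singleton l r ih =>
    rw [List.map_append, List.prod_append, List.map_singleton, List.prod_singleton, ← mul_assoc,
      fac, mul_add, mul_one, mul_smul_comm, map_add, map_smul,
      coeff_mul_gen (h r (by simp)), smul_zero, add_zero,
      ih fun r hr => h r (by simp [hr])]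

/-- Here `η` holds the factors further right. Working from the last index `k + L - 1` down, the
letters of `A n s` below the index commute with `η`, reach the right end and disappear because they
are not descents. The remaining factor is then absorbed into `η`: its letters exceed by at least 2
those still to be moved. -/
lemma coeff_block {w : SignedPerm} {s k : ℕ} (hsk : s ≤ k) (n : ℕ) (y : ℕ → R) :
    ∀ (L : ℕ) (ξ η : NilCoxeter R),
      (∀ r, s ≤ r → r + 1 < k + L → ¬ w.IsDescent r) →
      (∀ r, s ≤ r → r + 1 < k + L → Commute (gen r) η) →
      coeff w (ξ * ((List.range' k L).map fun i => A n s (y i)).prod * η) =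
        coeff w (ξ * ((List.range' k L).map fun i => A n i (y i)).prod * η) := by
  intro L
  induction L with
  | zero => simp
  | succ L ih =>
    intro ξ η hw hη
    simp only [List.range'_1_concat, List.map_append, List.prod_append, List.map_singleton,
      List.prod_singleton]
    have hP : Commute ((List.range' s (min (k + L) n - s)).reverse.map (fac (y (k + L)))).prod η := by
      refine Commute.list_prod_left _ _ fun ζ hζ => ?_
      obtain ⟨r, hr, rfl⟩ := List.mem_map.mp hζ
      rw [List.mem_reverse, List.mem_range'_1] at hr
      exact commute_fac _ (hη r (by omega) (by omega))
    have h1 : ∀ ζ : NilCoxeter R, coeff w (ζ * A n s (y (k + L)) * η) =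
        coeff w (ζ * A n (k + L) (y (k + L)) * η) := by
      intro ζ
      rw [A_eq_mul (show s ≤ k + L by omega), mul_assoc ζ, mul_assoc _ _ η, hP.eq, ← mul_assoc,
        ← mul_assoc, coeff_mul_prod_fac]
      intro r hr
      rw [List.mem_reverse, List.mem_range'_1] at hr
      exact hw r (by omega) (by omega)
    have h2 := ih ξ (A n (k + L) (y (k + L)) * η) (fun r h h' => hw r h (by omega))
      (fun r h h' => (commute_gen_A (by omega) _).mul_right (hη r h (by omega)))
    simp only [← mul_assoc] at h1 h2 ⊢
    rw [h1, h2]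

/-- The product of the `A_{a_j + 1}(y_i)` over `a_j < i ≤ a_{j+1}`. -/
noncomputable def blockA (n : ℕ) (a : ℕ → ℕ) (y : ℕ → R) (j : ℕ) : NilCoxeter R :=
  ((List.range' (a j + 1) (a (j + 1) - a j)).map fun i => A n (a j + 1) (y i)).prod

/-- The product of the `Ã_{b_j + 1}(z_i)` over `b_j < i ≤ b_{j+1}`. -/
noncomputable def blockAtilde (n : ℕ) (b : ℕ → ℕ) (z : ℕ → R) (j : ℕ) : NilCoxeter R :=
  ((List.range' (b j + 1) (b (j + 1) - b j)).map fun i => Atilde n (b j + 1) (z i)).prod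

lemma coeff_blocks_mul {w : SignedPerm} {p : ℕ} {a : ℕ → ℕ} (ha0 : a 0 = 0)
    (ha : ∀ i j, i ≤ j → j ≤ p → a i ≤ a j)
    (hw : ∀ r, w.IsDescent r → ∃ i ∈ Set.Icc 1 p, a i = r) (n : ℕ) (y : ℕ → R) :
    ∀ p' ≤ p, ∀ ξ η : NilCoxeter R,
    (∀ r, r < a p' → Commute (gen r) η) →
    coeff w (ξ * ((List.range' 1 (a p')).map fun i => A n i (y i)).prod * η) =
      coeff w (ξ * ((List.range p').map (blockA n a y)).prod * η) := by
  intro p'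
  induction p' with
  | zero => simp [ha0]
  | succ j ih =>
    intro hj ξ η hη
    have hle := ha j (j + 1) (by omega) hj
    have hl : List.range' 1 (a (j + 1)) =
        List.range' 1 (a j) ++ List.range' (a j + 1) (a (j + 1) - a j) := by
      rw [add_comm (a j) 1, List.range'_append_1]
      congr 1
      omega
    -- The block past `a j` joins `η`; its letters are at least `a j + 1`, so they commute with
    -- `u_r` for `r < a j`.
    have h1 := ih (by omega) ξ
      (((List.range' (a j + 1) (a (j + 1) - a j)).map fun i => A n i (y i)).prod * η) (by
        intro r hr
        refine Commute.mul_right (Commute.list_prod_right _ _ fun ζ hζ => ?_) (hη r (by omega))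
        obtain ⟨i, hi, rfl⟩ := List.mem_map.mp hζ
        rw [List.mem_range'_1] at hi
        exact commute_gen_A (by omega) _)
    -- No descent lies strictly between `a j` and `a (j + 1)`, by monotonicity of `a`.
    have h2 := coeff_block (w := w) (le_refl (a j + 1)) n y (a (j + 1) - a j)
      (ξ * ((List.range j).map (blockA n a y)).prod) η (by
        intro r hr hr' hd
        obtain ⟨i, ⟨hi1, hi2⟩, rfl⟩ := hw r hd
        rcases le_or_gt i j with h | h
        · have := ha i j h (by omega)
          omega
        · have := ha (j + 1) i h hi2
          omega) (fun r hr hr' => hη r (by omega))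
    rw [hl, List.range_succ]
    simp only [List.map_append, List.prod_append, List.map_singleton, List.prod_singleton,
      ← mul_assoc] at h1 h2 ⊢
    rw [h1, ← h2, blockA]

lemma coeff_prod_A_of_le {w : SignedPerm} {p : ℕ} {a : ℕ → ℕ} 
    (ha : ∀ i j, i ≤ j → j ≤ p → a i ≤ a j)
    (hw : ∀ r, w.IsDescent r → ∃ i ∈ Set.Icc 1 p, a i = r) (n : ℕ) (y : ℕ → R)
    (ξ : NilCoxeter R) {M : ℕ} (hM : a p ≤ M) :
    coeff w (ξ * ((List.range' 1 M).map fun i => A n i (y i)).prod) =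
      coeff w (ξ * ((List.range' 1 (a p)).map fun i => A n i (y i)).prod) := by
  induction M, hM using Nat.le_induction with
  | base => rfl
  | succ M hM ih =>
    rw [← ih, List.range'_1_concat, List.map_append, List.prod_append, List.map_singleton,
      List.prod_singleton, A, ← mul_assoc, coeff_mul_prod_fac]
    intro r hr hd
    rw [List.mem_reverse, List.mem_range'_1] at hr
    obtain ⟨i, ⟨hi1, hi2⟩, rfl⟩ := hw r hd
    have := ha i p hi2 le_rfl
    omega

lemma prod_A_of_le (n : ℕ) (y : ℕ → R) {M : ℕ} (hM : n - 1 ≤ M) :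
    ((List.range' 1 M).map fun i => A n i (y i)).prod =
      ((List.range' 1 (n - 1)).map fun i => A n i (y i)).prod := by
  induction M, hM using Nat.le_induction with
  | base => rfl
  | succ M hM ih =>
    rw [← ih, List.range'_1_concat, List.map_append, List.prod_append, List.map_singleton,
      List.prod_singleton, A_of_le (by omega), mul_one]

/-- If all descents of `w` are among `a_1, …, a_p`, then `A_i` may be replaced by `A_{a_j + 1}` for
`a_j < i ≤ a_{j+1}` and by `1` for `i > a_p`. -/
lemma coeff_blocks {w : SignedPerm} {p : ℕ} {a : ℕ → ℕ} (ha0 : a 0 = 0)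
    (ha : ∀ i j, i ≤ j → j ≤ p → a i ≤ a j)
    (hw : ∀ r, w.IsDescent r → ∃ i ∈ Set.Icc 1 p, a i = r) (n : ℕ) (y : ℕ → R)
    (ξ : NilCoxeter R) :
    coeff w (ξ * ((List.range' 1 (n - 1)).map fun i => A n i (y i)).prod) =
      coeff w (ξ * ((List.range p).map (blockA n a y)).prod) := by
  -- Either of `a p` and `n - 1` may be larger, so the product is first extended by trivial factors
  -- to a length exceeding both.
  rw [← prod_A_of_le n y (show n - 1 ≤ a p + n by omega),
    coeff_prod_A_of_le ha hw n y ξ (by omega)]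
  simpa using coeff_blocks_mul ha0 ha hw n y p le_rfl ξ 1 fun r _ => Commute.one_right _

/-- Reversal also reverses the order of the variables in the block; `commute_Atilde` restores it. -/
lemma rev_blockA (n : ℕ) (b : ℕ → ℕ) (z : ℕ → R) (j : ℕ) :
    rev (blockA n b (fun i => -z i) j) = blockAtilde n b z j := by
  rw [blockA, rev_list_prod, List.map_map, blockAtilde]
  have h : (rev ∘ fun i => A n (b j + 1) (-z i)) = fun i => Atilde n (b j + 1) (z i) := by
    funext i
    simp [rev_A]
  rw [h]
  refine (List.reverse_perm _).prod_eq' ?_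
  rw [List.pairwise_reverse, List.pairwise_map]
  exact List.pairwise_of_forall fun i i' => commute_Atilde (by omega) _ _

/-- This is `coeff_blocks` for `w⁻¹` and the variables `-z i`, read backwards. -/
lemma coeff_blocks_left {w : SignedPerm} {q : ℕ} {b : ℕ → ℕ} (hb0 : b 0 = 0)
    (hb : ∀ i j, i ≤ j → j ≤ q → b i ≤ b j)
    (hw : ∀ r, w⁻¹.IsDescent r → ∃ i ∈ Set.Icc 1 q, b i = r) (n : ℕ) (z : ℕ → R)
    (ξ : NilCoxeter R) :
    coeff w (((List.range' 1 (n - 1)).reverse.map fun i => Atilde n i (z i)).prod * ξ) =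
      coeff w (((List.range q).reverse.map (blockAtilde n b z)).prod * ξ) := by
  have h1 : rev ((List.range' 1 (n - 1)).map fun i => A n i (-z i)).prod =
      ((List.range' 1 (n - 1)).reverse.map fun i => Atilde n i (z i)).prod := by
    rw [rev_list_prod, List.map_map, List.map_reverse]
    congr 3
    funext i
    simp [rev_A]
  have h2 : rev ((List.range q).map (blockA n b fun i => -z i)).prod =
      ((List.range q).reverse.map (blockAtilde n b z)).prod := by
    rw [rev_list_prod, List.map_map, List.map_reverse]
    congr 3
    funext i
    exact rev_blockA n b z i
  have h3 := coeff_blocks hb0 hb hw n (fun i => -z i) (rev ξ)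
  rw [← coeff_rev, ← coeff_rev w⁻¹, rev_mul, rev_mul, rev_rev, inv_inv, h1, h2] at h3
  exact h3

end NilCoxeter
-- Block coefficients as Stanley functions, and the splitting formula.
namespace TypeC

open SignedPerm NilCoxeter

lemma blockA_eq_proj (n : ℕ) (a : ℕ → ℕ) (i : ℕ) :
    blockA n a y i = proj (fun j => a i < j) (prodA n (Yblock a (i + 1))) := by
  rw [prodA, map_list_prod, Yblock, List.map_map, List.map_map, blockA]
  congr 2
  funext l
  exact (proj_gt_A n (a i) (y l)).symm

lemma blockAtilde_eq_proj (n : ℕ) (b : ℕ → ℕ) (i : ℕ) :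
    blockAtilde n b z i = proj (fun j => b i < j) (prodAtilde n (Zblock b (i + 1))) := by
  rw [prodAtilde, map_list_prod, Zblock, List.map_map, List.map_map, blockAtilde]
  congr 2
  funext l
  exact (proj_gt_Atilde n (b i) (z l)).symm

lemma proj_lt_prodA {m n : ℕ} (h : m ≤ n) (Y : List K) :
    proj (fun j => j < m) (prodA n Y) = prodA m Y := by
  rw [prodA, map_list_prod, List.map_map, prodA]
  congr 2
  funext t
  exact proj_lt_A h 1 t

lemma proj_lt_prodAtilde {m n : ℕ} (h : m ≤ n) (Z : List K) :
    proj (fun j => j < m) (prodAtilde n Z) = prodAtilde m Z := by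
  rw [prodAtilde, map_list_prod, List.map_map, prodAtilde]
  congr 2
  funext t
  exact proj_lt_Atilde h 1 t

lemma proj_lt_prodC {m n : ℕ} (h : m ≤ n) (X : List K) :
    proj (fun j => j < m) (prodC n X) = prodC m X := by
  rw [prodC, map_list_prod, List.map_map, prodC]
  congr 2
  funext t
  exact proj_lt_C h t

/-- All letters of reduced words of `v` are below its rank, so a coefficient computed in a larger
`W_n` agrees with the one used in the definitions. -/
lemma coeff_proj_lt_rank (v : SignedPerm) (ξ : NilCoxeter K) :
    NilCoxeter.coeff v (proj (fun j => j < v.rank) ξ) = NilCoxeter.coeff v ξ :=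
  coeff_proj (fun _ hc hcv => hc.lt_of_memW (hcv ▸ v.memW_rank)) ξ

lemma coeff_proj_subgroupS {v : SignedPerm} {a : ℕ} (hv : v ∈ subgroupS a) (ξ : NilCoxeter K) :
    NilCoxeter.coeff v (proj (fun j => a < j) ξ) = NilCoxeter.coeff v ξ :=
  coeff_proj (fun _ hc hcv => hc.gt_of_mem_subgroupS (hcv ▸ hv)) ξ

lemma coeff_proj_of_notMem_subgroupS {v : SignedPerm} {a : ℕ} (hv : v ∉ subgroupS a)
    (ξ : NilCoxeter K) : NilCoxeter.coeff v (proj (fun j => a < j) ξ) = 0 :=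
  coeff_proj_eq_zero (fun c hcv hc => hv (by
    rw [← hcv]
    exact wordProd_mem fun i hi => simple_mem_subgroupS (hc i hi))) ξ

lemma coeff_blockA {v : SignedPerm} {n : ℕ} (hn : v.MemW n) {a : ℕ → ℕ} {i : ℕ}
    (hv : v ∈ subgroupS (a i)) :
    NilCoxeter.coeff v (blockA n a y i) = stanleyG (Yblock a (i + 1)) [] v := by
  rw [blockA_eq_proj, coeff_proj_subgroupS hv, ← coeff_proj_lt_rank, proj_lt_prodA (rank_le hn),
    stanleyG]
  simp [prodAtilde]

lemma coeff_blockAtilde {v : SignedPerm} {n : ℕ} (hn : v.MemW n) {b : ℕ → ℕ} {i : ℕ}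
    (hv : v ∈ subgroupS (b i)) :
    NilCoxeter.coeff v (blockAtilde n b z i) = stanleyG [] (Zblock b (i + 1)) v := by
  rw [blockAtilde_eq_proj, coeff_proj_subgroupS hv, ← coeff_proj_lt_rank,
    proj_lt_prodAtilde (rank_le hn), stanleyG]
  simp [prodA]

lemma blockA_zero (n : ℕ) {a : ℕ → ℕ} (ha0 : a 0 = 0) : blockA n a y 0 = prodA n (Yblock a 1) := by
  rw [prodA, Yblock, List.map_map, blockA, ha0]
  simp [Function.comp_def]

lemma blockAtilde_zero (n : ℕ) {b : ℕ → ℕ} (hb0 : b 0 = 0) :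
    blockAtilde n b z 0 = prodAtilde n (Zblock b 1) := by
  rw [prodAtilde, Zblock, List.map_map, blockAtilde, hb0]
  simp [Function.comp_def]

/-- The element whose coefficients are the factors attached to `u_j`, with `C(X)` replaced by
`C(x_1) ⋯ C(x_N)`. -/
noncomputable def splitElement (n N q : ℕ) (a b : ℕ → ℕ) (j : ℕ) : NilCoxeter K :=
  if j < q then blockAtilde n b z (q - j)
  else if j = q then
    blockAtilde n b z 0 * prodC n ((List.range' 1 N).map x) * blockA n a y 0
  else blockA n a y (j - q)

/-- Only the grouping changes: the two innermost blocks, for `Z_1` and `Y_1`, are merged with the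
product of the `C(x_i)` into the factor at `q`. -/
lemma prod_splitElement (n N : ℕ) {p q : ℕ} (hp : 1 ≤ p) (hq : 1 ≤ q) (a b : ℕ → ℕ) :
    (List.ofFn fun k : Fin (p + q - 1) => splitElement n N q a b (k + 1)).prod =
      ((List.range q).reverse.map (blockAtilde n b z)).prod *
        prodC n ((List.range' 1 N).map x) * ((List.range p).map (blockA n a y)).prod := by
  obtain ⟨p, rfl⟩ := Nat.exists_eq_add_of_le' hp
  obtain ⟨q, rfl⟩ := Nat.exists_eq_add_of_le' hq
  have h1 : (List.ofFn fun k : Fin (p + 1 + (q + 1) - 1) =>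
      splitElement n N (q + 1) a b (k + 1)) =
      (List.range q).map (fun k => blockAtilde n b z (q - k)) ++
        [blockAtilde n b z 0 * prodC n ((List.range' 1 N).map x) * blockA n a y 0] ++
        (List.range p).map (fun k => blockA n a y (k + 1)) := by
    apply List.ext_getElem
    · simp
      omega
    · intro k hk hk'
      simp only [List.getElem_ofFn, List.getElem_append, List.length_append, List.length_map,
        List.length_range, List.length_singleton, List.getElem_map, List.getElem_range,
        splitElement]
      split_ifs <;> first | omega | (congr 1; omega) | simp
  have h2 : (List.range (q + 1)).reverse.map (blockAtilde n b z) =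
      (List.range q).map (fun k => blockAtilde n b z (q - k)) ++ [blockAtilde n b z 0] := by
    apply List.ext_getElem
    · simp
    · intro k hk hk'
      simp only [List.getElem_append, List.length_map, List.length_range, List.getElem_map,
        List.getElem_range, List.getElem_reverse]
      split_ifs with h
      · congr 1
      · simp only [List.length_map, List.length_reverse, List.length_range] at hk
        rw [List.getElem_singleton]
        congr 1
        omega
  rw [h1, h2, List.range_succ_eq_map]
  simp only [List.prod_append, List.map_cons, List.prod_cons, List.map_map, List.prod_nil, mul_one,
    mul_assoc]
  rfl

/-- A nonzero coefficient of an outer block forces `u_k` into the corresponding parabolic subgroup,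
and these memberships are all that compatibility adds to a reduced factorization. -/
lemma prod_coeff_splitElement_eq_zero {p q n N : ℕ} {a b : ℕ → ℕ} {w : SignedPerm}
    {u : Fin (p + q - 1) → SignedPerm} (hu : u ∈ reducedFactorizations (p + q - 1) w)
    (h : ¬ IsCompatibleFactorization p q a b w u) :
    ∏ k, NilCoxeter.coeff (u k) (splitElement n N q a b ((k : ℕ) + 1)) = 0 := by
  by_contra h0
  rw [← ne_eq, Finset.prod_ne_zero_iff] at h0
  have hl : ∀ k : Fin (p + q - 1), (k : ℕ) + 1 < q → u k ∈ subgroupS (b (q - (k + 1))) := by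
    intro k hk
    by_contra hv
    apply h0 k (Finset.mem_univ k)
    rw [splitElement, if_pos hk, blockAtilde_eq_proj, coeff_proj_of_notMem_subgroupS hv]
  have hr : ∀ k : Fin (p + q - 1), q < (k : ℕ) + 1 → u k ∈ subgroupS (a ((k + 1) - q)) := by
    intro k hk
    by_contra hv
    apply h0 k (Finset.mem_univ k)
    rw [splitElement, if_neg (by omega), if_neg (by omega), blockA_eq_proj,
      coeff_proj_of_notMem_subgroupS hv]
  refine h ⟨hu.1, hu.2, fun k hk => ?_, fun k hk => (hl k hk).2, fun k hk => (hr k hk).2⟩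
  rcases lt_or_gt_of_ne hk with hk | hk
  · exact (hl k hk).1
  · exact (hr k hk).1

/-- Needed because the truncated middle factor agrees with the mixed Stanley function only in the
exponents that divide `d`. -/
lemma coeff_prod_congr {ι : Type*} (s : Finset ι) {f g : ι → K} {d : ℕ →₀ ℕ}
    (h : ∀ k ∈ s, ∀ e ≤ d, MvPowerSeries.coeff e (f k) = MvPowerSeries.coeff e (g k)) :
    ∀ e ≤ d, MvPowerSeries.coeff e (∏ k ∈ s, f k) = MvPowerSeries.coeff e (∏ k ∈ s, g k) := by
  classical
  induction s using Finset.induction_on with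
  | empty => simp
  | insert k s hk ih =>
    intro e he
    rw [Finset.prod_insert hk, Finset.prod_insert hk, MvPowerSeries.coeff_mul,
      MvPowerSeries.coeff_mul]
    refine Finset.sum_congr rfl fun ij hij => ?_
    rw [Finset.HasAntidiagonal.mem_antidiagonal] at hij
    rw [h k (Finset.mem_insert_self k s) _ ((hij ▸ le_self_add).trans he),
      ih (fun l hl => h l (Finset.mem_insert_of_mem hl)) _ ((hij ▸ le_add_self).trans he)]

lemma coeff_splitElement {p q n : ℕ} {a b : ℕ → ℕ} (ha0 : a 0 = 0) (hb0 : b 0 = 0)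
    {w : SignedPerm} (hn : w.MemW n) {u : Fin (p + q - 1) → SignedPerm}
    (hu : IsCompatibleFactorization p q a b w u) (k : Fin (p + q - 1)) {d e : ℕ →₀ ℕ}
    (he : e ≤ d) :
    MvPowerSeries.coeff e
        (NilCoxeter.coeff (u k) (splitElement n (d.support.sup id) q a b ((k : ℕ) + 1))) =
      MvPowerSeries.coeff e (splitFactor q a b ((k : ℕ) + 1) (u k)) := by
  have hk := memW_of_mem_reducedFactorizations hn ⟨hu.prod_eq, hu.length_eq⟩ k
  rw [splitElement, splitFactor]
  split_ifs with h1 h2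
  · rw [coeff_blockAtilde hk ⟨hu.memS k (by omega), hu.fix_left k h1⟩]
    congr 3
    omega
  -- For `e ≤ d` the support of `e` lies in that of `d`, so the cutoff chosen for `d` also suffices
  -- for `e`.
  · rw [mixedStanleyJ, coeff_coeffCX _ _ _ _ _ _ (Finset.sup_mono (Finsupp.support_mono he)),
      blockA_zero n ha0, blockAtilde_zero n hb0, ← coeff_proj_lt_rank,
      map_mul (proj _), map_mul (proj _),
      proj_lt_prodA (rank_le hk), proj_lt_prodAtilde (rank_le hk), proj_lt_prodC (rank_le hk)]
  · rw [coeff_blockA hk ⟨hu.memS k h2, hu.fix_right k (by omega)⟩]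
    congr 3
    omega

/-- Only weak monotonicity survives at index `0`, since `a 1 = 0` is allowed; the first block is
then empty. -/
lemma le_of_strictMonoOn {p : ℕ} {a : ℕ → ℕ} (ha0 : a 0 = 0)
    (ha : StrictMonoOn a (Set.Icc 1 p)) : ∀ i j, i ≤ j → j ≤ p → a i ≤ a j := by
  intro i j hij hj
  rcases Nat.eq_zero_or_pos i with rfl | hi
  · omega
  · exact ha.monotoneOn ⟨hi, hij.trans hj⟩ ⟨hi.trans_le hij, hj⟩ hij

end TypeC

open TypeC NilCoxeter in
theorem proposition3p6 (w : SignedPerm) (p q : ℕ) (hp : 1 ≤ p) (hq : 1 ≤ q)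
    (a b : ℕ → ℕ) (ha0 : a 0 = 0) (hb0 : b 0 = 0)
    (ha : StrictMonoOn a (Set.Icc 1 p)) (hb : StrictMonoOn b (Set.Icc 1 q))
    (hwa : TypeC.Compatible w p a) (hwb : TypeC.Compatible w⁻¹ q b) :
    {u | TypeC.IsCompatibleFactorization p q a b w u}.Finite ∧
      TypeC.schubert w =
        ∑ᶠ u ∈ {u | TypeC.IsCompatibleFactorization p q a b w u},
          ∏ k : Fin (p + q - 1), TypeC.splitFactor q a b ((k : ℕ) + 1) (u k) := by
  classical
  have hsub : {u | IsCompatibleFactorization p q a b w u} ⊆ reducedFactorizations (p + q - 1) w :=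
    fun u hu => ⟨hu.prod_eq, hu.length_eq⟩
  have hfin := (finite_reducedFactorizations (p + q - 1) w).subset hsub
  refine ⟨hfin, ?_⟩
  rw [finsum_mem_eq_finite_toFinset_sum _ hfin]
  ext1 d
  rw [map_sum]
  set N := d.support.sup id with hN
  have h1 : MvPowerSeries.coeff d (schubert w) = MvPowerSeries.coeff d (NilCoxeter.coeff w
      (List.ofFn fun k : Fin (p + q - 1) => splitElement w.rank N q a b (k + 1)).prod) := by
    rw [schubert, coeff_coeffCX _ _ _ _ _ _ le_rfl, prod_splitElement _ _ hp hq,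
      coeff_blocks ha0 (le_of_strictMonoOn ha0 ha) hwa, mul_assoc, mul_assoc,
      coeff_blocks_left hb0 (le_of_strictMonoOn hb0 hb) hwb]
  rw [h1, coeff_prod_ofFn, map_sum]
  -- The sum over all reduced factorizations reduces to the compatible ones, the others contributing
  -- zero.
  refine (Finset.sum_subset_zero_on_sdiff ?_ ?_ ?_).symm
  · exact Set.Finite.toFinset_subset_toFinset.mpr hsub
  · intro u hu
    simp only [Finset.mem_sdiff, Set.Finite.mem_toFinset] at hu
    rw [prod_coeff_splitElement_eq_zero hu.1 hu.2, map_zero]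
  · intro u hu
    rw [Set.Finite.mem_toFinset] at hu
    exact (coeff_prod_congr _ (fun k _ e he =>
      coeff_splitElement ha0 hb0 w.memW_rank hu k he) d le_rfl).symm
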